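/- Let $\Omega\subset\mathbf R^3$ be a bounded open set, $a,b>0$, and let $f,g\in C_c(\Omega)$ be continuous with compact support in $\Omega$. For every $\varepsilon>0$ let $r_\varepsilon>0$, and assume that $r_\varepsilon/\varepsilon^3\to\gamma$ as $\varepsilon\to0^+$ for some $\gamma\in(0,+\infty)$. With $Y=(-\tfrac12,\tfrac12)^3$ put $$T_\varepsilon=\bigcup_{k\in\mathbf Z^3,\ \varepsilon k+\varepsilon Y\subset\Omega}\overline{B}(\varepsilon k,r_\varepsilon),\qquad \Omega_\varepsilon=\Omega\setminus T_\varepsilon,\qquad V_\varepsilon=\{v\in H_0^1(\Omega_\varepsilon;\mathbf R^3):\ \operatorname{div}v=0\},$$ where $\overline B(x,\rho)$ is the closed ball with centre $x$ and radius $\rho$. For $\alpha>0$ consider the problem: find $(u^\varepsilon,\theta^\varepsilon)\in V_\varepsilon\times H_0^1(\Omega)$ such that for all $(v,\varphi)\in V_\varepsilon\times H_0^1(\Omega)$ $$\alpha\int_{\Omega_\varepsilon}\nabla u^\varepsilon\cdot\nabla v\,dx-\alpha a\int_{\Omega_\varepsilon}\theta^\varepsilon v_3\,dx+\int_{\Omega_\varepsilon}\nabla\theta^\varepsilon\cdot\nabla\varphi\,dx+\int_{\Omega_\varepsilon}\varphi\,u^\varepsilon\cdot\nabla\theta^\varepsilon\,dx+b\Big(\frac{\varepsilon}{r_\varepsilon}\Big)^3\int_{T_\varepsilon}\nabla\theta^\varepsilon\cdot\nabla\varphi\,dx$$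 $$=\int_{\Omega_\varepsilon}f\varphi\,dx+b\Big(\frac{\varepsilon}{r_\varepsilon}\Big)^3\int_{T_\varepsilon}g\varphi\,dx .\qquad(12)$$ Then there are constants $C$ and $\varepsilon_0>0$, independent of $\varepsilon$, of $\alpha$ and of the solution, such that, for all $0<\varepsilon<\varepsilon_0$, all $\alpha>0$ and every solution $(u^\varepsilon,\theta^\varepsilon)$ of (12), the extension $\hat u^\varepsilon$ of $u^\varepsilon$ by zero to $\Omega$ belongs to $H_0^1(\Omega;\mathbf R^3)$ and $$\|\hat u^\varepsilon\|_{H^1(\Omega;\mathbf R^3)}^2\le C,\qquad \|\theta^\varepsilon\|_{H^1(\Omega)}^2\le C,\qquad \int_{\Omega_\varepsilon}|\nabla\theta^\varepsilon|^2dx+b\Big(\frac{\varepsilon}{r_\varepsilon}\Big)^3\int_{T_\varepsilon}|\nabla\theta^\varepsilon|^2dx\le C .$$ -/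

import Mathlib

open MeasureTheory Filter Topology
open scoped ContDiff

noncomputable section

/-- The physical space `ℝ³` with its Euclidean norm. -/
abbrev R3 : Type := EuclideanSpace ℝ (Fin 3)

/-! ### Sobolev spaces through weak derivatives -/

/-- `φ ∈ 𝒟(U)`: a smooth function with compact support contained in `U`. -/
def IsTest (U : Set R3) (φ : R3 → ℝ) : Prop :=
  ContDiff ℝ ∞ φ ∧ HasCompactSupport φ ∧ tsupport φ ⊆ U

/-- `G` is the weak (distributional) gradient of `w` on the open set `U`. -/
def IsWeakGradient (U : Set R3) (w : R3 → ℝ) (G : R3 → R3) : Prop :=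
  LocallyIntegrableOn w U ∧ LocallyIntegrableOn G U ∧
    ∀ φ : R3 → ℝ, IsTest U φ → ∀ i : Fin 3,
      ∫ x in U, w x * fderiv ℝ φ x (EuclideanSpace.single i 1) = -∫ x in U, G x i * φ x

open Classical in
/-- The weak gradient `∇w` of `w` on `U` (unique up to null sets when it exists, and `0` by
convention when it does not exist). -/
def weakGradient (U : Set R3) (w : R3 → ℝ) : R3 → R3 :=
  if h : ∃ G, IsWeakGradient U w G then h.choose else 0

/-- `w ∈ H¹(U)`: both `w` and its weak gradient are square integrable on `U`. -/
def MemH1 (U : Set R3) (w : R3 → ℝ) : Prop :=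
  MemLp w 2 (volume.restrict U) ∧
    ∃ G, IsWeakGradient U w G ∧ MemLp G 2 (volume.restrict U)

/-- The square of the norm of `H¹(U)`. -/
def h1NormSq (U : Set R3) (w : R3 → ℝ) : ℝ :=
  (∫ x in U, (w x) ^ 2) + ∫ x in U, ‖weakGradient U w x‖ ^ 2

/-- `w ∈ H¹₀(U)`: `w` lies in the closure of `𝒟(U)` in `H¹(U)`. -/
def MemH10 (U : Set R3) (w : R3 → ℝ) : Prop :=
  MemH1 U w ∧ ∀ δ : ℝ, 0 < δ → ∃ φ, IsTest U φ ∧ h1NormSq U (fun x => w x - φ x) < δ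

/-- `v ∈ H¹₀(U; ℝ³)`. -/
def MemH10Vec (U : Set R3) (v : R3 → R3) : Prop :=
  ∀ i : Fin 3, MemH10 U (fun x => v x i)

/-- The square of the norm of `H¹(U; ℝ³)`. -/
def h1NormSqVec (U : Set R3) (v : R3 → R3) : ℝ :=
  ∑ i : Fin 3, h1NormSq U (fun x => v x i)

/-- The weak divergence `div v = ∑ᵢ ∂ᵢ vᵢ` on `U`. -/
def weakDiv (U : Set R3) (v : R3 → R3) (x : R3) : ℝ :=
  ∑ i : Fin 3, weakGradient U (fun y => v y i) x i

/-! ### The geometry -/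

/-- The unit cell `Y = (-1/2, 1/2)³`. -/
def unitCell : Set R3 := {y | ∀ i, -(1 / 2 : ℝ) < y i ∧ y i < 1 / 2}

/-- The lattice point `ε k`, for `k ∈ ℤ³`. -/
def latticePoint (ε : ℝ) (k : Fin 3 → ℤ) : R3 := WithLp.toLp 2 (fun i => ε * (k i : ℝ))

/-- The cell `ε k + ε Y`. -/
def cell (ε : ℝ) (k : Fin 3 → ℤ) : Set R3 :=
  (fun y : R3 => latticePoint ε k + ε • y) '' unitCell

/-- The indices `k ∈ ℤ³` of the cells contained in `Ω`. -/
def cellIndices (Ω : Set R3) (ε : ℝ) : Set (Fin 3 → ℤ) := {k | cell ε k ⊆ Ω}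

/-- The union `T_ε` of the solid spherical suspensions of radius `ρ`; the balls are closed, so that
the fluid domain is open. -/
def solid (Ω : Set R3) (ε ρ : ℝ) : Set R3 :=
  ⋃ k ∈ cellIndices Ω ε, Metric.closedBall (latticePoint ε k) ρ

/-- The fluid domain `Ω_ε = Ω \ T_ε`. -/
def fluid (Ω : Set R3) (ε ρ : ℝ) : Set R3 := Ω \ solid Ω ε ρ

/-! ### The variational problem -/

/-- `v ∈ V_ε`: `v ∈ H¹₀(Ω_ε; ℝ³)` and `div v = 0`. -/
def MemV (Ω : Set R3) (ε ρ : ℝ) (v : R3 → R3) : Prop :=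
  MemH10Vec (fluid Ω ε ρ) v ∧
    ∀ᵐ x ∂(volume.restrict (fluid Ω ε ρ)), weakDiv (fluid Ω ε ρ) v x = 0

/-- The pairing `⟨G(u, θ), (v, φ)⟩`. The third velocity component has index `2 : Fin 3`. -/
def pairG (Ω : Set R3) (a b α ε ρ : ℝ) (u : R3 → R3) (θ : R3 → ℝ)
    (v : R3 → R3) (φ : R3 → ℝ) : ℝ :=
  α * (∫ x in fluid Ω ε ρ, ∑ i : Fin 3,
      inner ℝ (weakGradient (fluid Ω ε ρ) (fun y => u y i) x)
        (weakGradient (fluid Ω ε ρ) (fun y => v y i) x))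
    - α * a * (∫ x in fluid Ω ε ρ, θ x * v x 2)
    + (∫ x in fluid Ω ε ρ, inner ℝ (weakGradient Ω θ x) (weakGradient Ω φ x))
    + (∫ x in fluid Ω ε ρ, φ x * inner ℝ (u x) (weakGradient Ω θ x))
    + b * (ε / ρ) ^ 3 * (∫ x in solid Ω ε ρ, inner ℝ (weakGradient Ω θ x) (weakGradient Ω φ x))

/-- The functional `𝓕_ε`. -/
def sourceF (Ω : Set R3) (b ε ρ : ℝ) (f g : R3 → ℝ) (φ : R3 → ℝ) : ℝ :=
  (∫ x in fluid Ω ε ρ, f x * φ x) + b * (ε / ρ) ^ 3 * ∫ x in solid Ω ε ρ, g x * φ x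

/-- `(u, θ) ∈ V_ε × H¹₀(Ω)` solves the variational problem
`⟨G(u, θ), (v, φ)⟩ = 𝓕_ε(φ)` for all `(v, φ) ∈ V_ε × H¹₀(Ω)`. -/
def IsSolution (Ω : Set R3) (a b α ε ρ : ℝ) (f g : R3 → ℝ) (u : R3 → R3) (θ : R3 → ℝ) : Prop :=
  MemV Ω ε ρ u ∧ MemH10 Ω θ ∧
    ∀ (v : R3 → R3) (φ : R3 → ℝ), MemV Ω ε ρ v → MemH10 Ω φ →
      pairG Ω a b α ε ρ u θ v φ = sourceF Ω b ε ρ f g φ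

/-- The extension by zero `û` of a velocity `u` given on the fluid domain. -/
def zeroExt (Ω : Set R3) (ε ρ : ℝ) (u : R3 → R3) : R3 → R3 :=
  (fluid Ω ε ρ).indicator u

end

/-! ### Square integrable functions -/

section LebesgueSpaces

variable {α E : Type*} [MeasurableSpace α] {μ : Measure α} [NormedAddCommGroup E]

/-! Testing with `(0, θ)` gives the temperature energy `E = ∫_{Ω_ε} |∇θ|² + β ∫_{T_ε} |∇θ|²`, with
`β = b (ε/ρ)³`, as the value of the source on `θ`: the convection term is `½ ∫ u · ∇(θ²)`, which
vanishes because `u` is solenoidal and lies in `H¹₀(Ω_ε)`. For small `ε` one has `β ≥ 1`, so `E`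
dominates `∫_Ω |∇θ|²`. Testing with `(u, 0)` gives the velocity energy; the factor `α` cancels,
hence the uniformity in `α`.

The difficulty is the source on the solid, since `β` blows up like `ε⁻⁶`. As `|T_ε|` is of order at
most `(ρ/ε)³`, Cauchy–Schwarz leaves a bounded factor exactly when `∫_{T_ε} θ² ≤ K ρ² ∫_Ω |∇θ|²`:
the powers then combine to `ε³/ρ`, which tends to `1/γ`.

That inequality (`MemH10.setIntegral_sq_solid_le`) comes from a positive supersolution. If `ψ > 0`,
then `∫ (-Δψ/ψ) φ² ≤ ∫ |∇φ|²` for test functions `φ`. For `ψ` equal to `1` plus a sum of regularised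
Newtonian potentials of size `ρ` centred at the balls, `-Δψ` is at least of order `ρ⁻²` on the
balls, and `ψ` is bounded there because the lattice sum is of order `ρ/ε³`. The same principle with
an explicit linear field gives Poincaré's inequality. -/

theorem eLpNorm_two_sq_eq_ofReal {f : α → E} (hf : MemLp f 2 μ) :
    eLpNorm f 2 μ ^ 2 = ENNReal.ofReal (∫ x, ‖f x‖ ^ 2 ∂μ) := by
  have h0 : 0 ≤ ∫ x, ‖f x‖ ^ 2 ∂μ := integral_nonneg fun x => by positivity
  rw [hf.eLpNorm_eq_integral_rpow_norm (by norm_num) (by norm_num),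
    ← ENNReal.ofReal_pow (by positivity)]
  congr 1
  have h1 : (∫ x, ‖f x‖ ^ (2 : ENNReal).toReal ∂μ) = ∫ x, ‖f x‖ ^ 2 ∂μ := by
    norm_num
  rw [h1, ← Real.rpow_natCast, ← Real.rpow_mul h0]
  norm_num

/-- Fatou arguments run on `eLpNorm`, energy estimates on integrals of squares. Two measures are
allowed so that a norm on a subset can be compared with a gradient norm on the whole domain. -/
theorem eLpNorm_two_le_iff {F : Type*} [NormedAddCommGroup F] {ν : Measure α} {f : α → E}
    {g : α → F} (hf : MemLp f 2 μ) (hg : MemLp g 2 ν) {c : ℝ} (hc : 0 ≤ c) :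
    eLpNorm f 2 μ ≤ ENNReal.ofReal c * eLpNorm g 2 ν ↔
      ∫ x, ‖f x‖ ^ 2 ∂μ ≤ c ^ 2 * ∫ x, ‖g x‖ ^ 2 ∂ν := by
  have h0 : 0 ≤ ∫ x, ‖g x‖ ^ 2 ∂ν := integral_nonneg fun x => by positivity
  rw [← ENNReal.pow_le_pow_left_iff (n := 2) (by norm_num), mul_pow, eLpNorm_two_sq_eq_ofReal hf,
    eLpNorm_two_sq_eq_ofReal hg, ← ENNReal.ofReal_pow hc, ← ENNReal.ofReal_mul (by positivity),
    ENNReal.ofReal_le_ofReal_iff (by positivity)]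

theorem sq_integral_mul_le {f g : α → ℝ} (hf : MemLp f 2 μ) (hg : MemLp g 2 μ) :
    (∫ x, f x * g x ∂μ) ^ 2 ≤ (∫ x, f x ^ 2 ∂μ) * ∫ x, g x ^ 2 ∂μ := by
  have hff : Integrable (fun x => f x ^ 2) μ := hf.integrable_sq
  have hgg : Integrable (fun x => g x ^ 2) μ := hg.integrable_sq
  have hfg : Integrable (fun x => f x * g x) μ := hf.integrable_mul hg
  have key : ∀ t : ℝ, 0 ≤ (∫ x, g x ^ 2 ∂μ) * (t * t) + (2 * ∫ x, f x * g x ∂μ) * t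
      + ∫ x, f x ^ 2 ∂μ := by
    intro t
    have h : ∫ x, (f x + t * g x) ^ 2 ∂μ = (∫ x, g x ^ 2 ∂μ) * (t * t)
        + (2 * ∫ x, f x * g x ∂μ) * t + ∫ x, f x ^ 2 ∂μ := by
      have e : (fun x => (f x + t * g x) ^ 2)
          = fun x => (t * t) * g x ^ 2 + (2 * t) * (f x * g x) + f x ^ 2 := by
        ext x; ring
      have i1 : Integrable (fun x => (t * t) * g x ^ 2) μ := hgg.const_mul _
      have i2 : Integrable (fun x => (2 * t) * (f x * g x)) μ := hfg.const_mul _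
      have i3 : Integrable (fun x => (t * t) * g x ^ 2 + (2 * t) * (f x * g x)) μ := i1.add i2
      rw [e, integral_add i3 hff, integral_add i1 i2, integral_const_mul, integral_const_mul]
      ring
    rw [← h]
    exact integral_nonneg fun x => sq_nonneg _
  -- A nonnegative quadratic polynomial in `t` has nonpositive discriminant.
  have := discrim_le_zero key
  unfold discrim at this
  nlinarith

theorem tendsto_integral_mul_of_tendsto_eLpNorm {f g : α → ℝ} {F G : ℕ → α → ℝ}
    (hf : MemLp f 2 μ) (hF : ∀ n, MemLp (F n) 2 μ)
    (hg : MemLp g 2 μ) (hG : ∀ n, MemLp (G n) 2 μ)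
    (h : Tendsto (fun n => eLpNorm (f - F n) 2 μ) atTop (𝓝 0))
    (h' : Tendsto (fun n => eLpNorm (g - G n) 2 μ) atTop (𝓝 0)) :
    Tendsto (fun n => ∫ x, F n x * G n x ∂μ) atTop (𝓝 (∫ x, f x * g x ∂μ)) := by
  have key : ∀ {f g : α → ℝ} (hf : MemLp f 2 μ) (hg : MemLp g 2 μ),
      ∫ x, f x * g x ∂μ = inner ℝ (hg.toLp g) (hf.toLp f) := by
    intro f g hf hg
    rw [L2.inner_def]
    refine integral_congr_ae ?_
    filter_upwards [hf.coeFn_toLp, hg.coeFn_toLp] with x h1 h2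
    simp [h1, h2]
  have lim : ∀ {f : α → ℝ} {F : ℕ → α → ℝ} (hf : MemLp f 2 μ) (hF : ∀ n, MemLp (F n) 2 μ),
      Tendsto (fun n => eLpNorm (f - F n) 2 μ) atTop (𝓝 0) →
      Tendsto (fun n => (hF n).toLp (F n)) atTop (𝓝 (hf.toLp f)) := by
    intro f F hf hF h
    rw [Lp.tendsto_Lp_iff_tendsto_eLpNorm'']
    refine h.congr fun n => ?_
    rw [eLpNorm_sub_comm]
  rw [key hf hg]
  simp only [fun n => key (hF n) (hG n)]
  exact (lim hg hG h').inner (lim hf hF h)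

end LebesgueSpaces

/-! ### Weak gradients -/

theorem MeasureTheory.LocallyIntegrableOn.integrableOn_mul_of_isTest {U : Set R3} {w : R3 → ℝ}
    (hw : LocallyIntegrableOn w U) {φ : R3 → ℝ} (hφ : Continuous φ)
    (hc : HasCompactSupport φ) (hs : tsupport φ ⊆ U) :
    Integrable (fun x => w x * φ x) (volume.restrict U) := by
  have h1 : IntegrableOn w (tsupport φ) := hw.integrableOn_compact_subset hs hc
  have h2 : IntegrableOn (fun x => w x * φ x) (tsupport φ) :=
    h1.mul_continuousOn hφ.continuousOn hc
  refine Integrable.integrableOn ?_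
  rw [← integrableOn_iff_integrable_of_support_subset (s := tsupport φ)]
  · exact h2
  · intro x hx
    apply subset_tsupport
    intro h0
    exact hx (by simp [h0])

theorem MeasureTheory.LocallyIntegrableOn.apply {U : Set R3} {G : R3 → R3} (h : LocallyIntegrableOn G U)
    (i : Fin 3) : LocallyIntegrableOn (fun x => G x i) U := by
  intro x hx
  obtain ⟨s, hs, h⟩ := h x hx
  exact ⟨s, hs, (EuclideanSpace.proj (𝕜 := ℝ) i).integrable_comp h⟩

theorem MeasureTheory.MemLp.eucl_apply {μ : Measure R3} {p : ENNReal} {G : R3 → R3} (h : MemLp G p μ)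
    (i : Fin 3) : MemLp (fun x => G x i) p μ :=
  (EuclideanSpace.proj (𝕜 := ℝ) i).comp_memLp' h

theorem gradient_apply (φ : R3 → ℝ) (x : R3) (i : Fin 3) :
    gradient φ x i = fderiv ℝ φ x (EuclideanSpace.single i 1) := by
  rw [← inner_gradient_left, EuclideanSpace.inner_single_right]
  simp

theorem norm_gradient (φ : R3 → ℝ) (x : R3) : ‖gradient φ x‖ = ‖fderiv ℝ φ x‖ := by
  simp [gradient]

theorem norm_sq_eq_sum (v : R3) : ‖v‖ ^ 2 = ∑ i, v i ^ 2 := by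
  rw [EuclideanSpace.norm_sq_eq]; simp

theorem continuous_gradient {φ : R3 → ℝ} (h : ContDiff ℝ 1 φ) : Continuous (gradient φ) :=
  (InnerProductSpace.toDual ℝ R3).symm.continuous.comp (h.continuous_fderiv (by norm_num))

theorem HasCompactSupport.gradient {φ : R3 → ℝ} (h : HasCompactSupport φ) :
    HasCompactSupport (gradient φ) :=
  (h.fderiv (𝕜 := ℝ)).comp_left (g := (InnerProductSpace.toDual ℝ R3).symm) (map_zero _)

theorem setIntegral_eq_of_tsupport {U : Set R3} {φ : R3 → ℝ} (h : tsupport φ ⊆ U) (F : R3 → ℝ)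
    (hF : ∀ x, φ x = 0 → F x = 0) : ∫ x in U, F x = ∫ x, F x :=
  setIntegral_eq_integral_of_forall_compl_eq_zero fun x hx =>
    hF x (image_eq_zero_of_notMem_tsupport fun h' => hx (h h'))

theorem integral_mul_fderiv_single {f g : R3 → ℝ} (hf : ContDiff ℝ 1 f) (hg : ContDiff ℝ 1 g)
    (hc : HasCompactSupport g) (v : R3) :
    ∫ x, f x * fderiv ℝ g x v = -∫ x, fderiv ℝ f x v * g x := by
  have cf : Continuous fun x => fderiv ℝ f x v :=
    (hf.continuous_fderiv (by norm_num)).clm_apply continuous_const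
  have cg : Continuous fun x => fderiv ℝ g x v :=
    (hg.continuous_fderiv (by norm_num)).clm_apply continuous_const
  refine integral_mul_fderiv_eq_neg_fderiv_mul_of_integrable ?_ ?_ ?_
    (fun x _ => hf.differentiable (by norm_num) x) (fun x _ => hg.differentiable (by norm_num) x)
  · exact (cf.mul hg.continuous).integrable_of_hasCompactSupport hc.mul_left
  · exact (hf.continuous.mul cg).integrable_of_hasCompactSupport
      (hc.fderiv_apply (𝕜 := ℝ) v).mul_left
  · exact (hf.continuous.mul hg.continuous).integrable_of_hasCompactSupport hc.mul_left

theorem tsupport_fderiv_apply_le (φ : R3 → ℝ) (v : R3) :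
    tsupport (fun x => fderiv ℝ φ x v) ⊆ tsupport φ :=
  tsupport_fderiv_apply_subset ℝ v

theorem IsTest.contDiff_one {U : Set R3} {φ : R3 → ℝ} (h : IsTest U φ) : ContDiff ℝ 1 φ :=
  h.1.of_le (by exact_mod_cast le_top)

theorem IsTest.mono {U V : Set R3} {φ : R3 → ℝ} (h : IsTest U φ) (hUV : U ⊆ V) : IsTest V φ :=
  ⟨h.1, h.2.1, h.2.2.trans hUV⟩

theorem IsTest.sub {U : Set R3} {φ ψ : R3 → ℝ} (h : IsTest U φ) (h' : IsTest U ψ) :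
    IsTest U (fun x => φ x - ψ x) :=
  ⟨h.1.sub h'.1, h.2.1.sub h'.2.1, (tsupport_sub φ ψ).trans (Set.union_subset h.2.2 h'.2.2)⟩

theorem isWeakGradient_gradient {U : Set R3} {w : R3 → ℝ} (hw : ContDiff ℝ 1 w) :
    IsWeakGradient U w (gradient w) := by
  refine ⟨hw.continuous.locallyIntegrable.locallyIntegrableOn _,
    (continuous_gradient hw).locallyIntegrable.locallyIntegrableOn _, fun φ hφ i => ?_⟩
  rw [setIntegral_eq_of_tsupport ((tsupport_fderiv_apply_le φ _).trans hφ.2.2) _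
      (fun x hx => by rw [hx, mul_zero]),
    setIntegral_eq_of_tsupport hφ.2.2 _ (fun x hx => by rw [hx, mul_zero]),
    integral_mul_fderiv_single hw hφ.contDiff_one hφ.2.1]
  simp only [gradient_apply]

theorem IsWeakGradient.sub {U : Set R3} {w w' : R3 → ℝ} {G G' : R3 → R3}
    (h : IsWeakGradient U w G) (h' : IsWeakGradient U w' G') :
    IsWeakGradient U (fun x => w x - w' x) (G - G') := by
  refine ⟨h.1.sub h'.1, h.2.1.sub h'.2.1, fun φ hφ i => ?_⟩
  have hdc : Continuous fun x => fderiv ℝ φ x (EuclideanSpace.single i 1) :=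
    (hφ.contDiff_one.continuous_fderiv (by norm_num)).clm_apply continuous_const
  have hdk : HasCompactSupport fun x => fderiv ℝ φ x (EuclideanSpace.single i 1) :=
    hφ.2.1.fderiv_apply (𝕜 := ℝ) _
  have hds := (tsupport_fderiv_apply_le φ (EuclideanSpace.single i 1)).trans hφ.2.2
  simp only [Pi.sub_apply, PiLp.sub_apply, sub_mul]
  rw [integral_sub (h.1.integrableOn_mul_of_isTest hdc hdk hds)
      (h'.1.integrableOn_mul_of_isTest hdc hdk hds),
    integral_sub ((h.2.1.apply i).integrableOn_mul_of_isTest hφ.1.continuous hφ.2.1 hφ.2.2)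
      ((h'.2.1.apply i).integrableOn_mul_of_isTest hφ.1.continuous hφ.2.1 hφ.2.2),
    h.2.2 φ hφ i, h'.2.2 φ hφ i]
  ring

/-- The difference is a weak gradient of `w - w = 0`, so the fundamental lemma of the calculus of
variations applies to each component. This makes the chosen `weakGradient` computable almost
everywhere. -/
theorem IsWeakGradient.ae_eq {U : Set R3} (hU : IsOpen U) {w : R3 → ℝ} {G G' : R3 → R3}
    (h : IsWeakGradient U w G) (h' : IsWeakGradient U w G') : G =ᵐ[volume.restrict U] G' := by
  have hs := h.sub h'
  have key : ∀ i : Fin 3, ∀ᵐ x, x ∈ U → (G - G') x i = 0 := by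
    intro i
    refine hU.ae_eq_zero_of_integral_contDiff_smul_eq_zero (hs.2.1.apply i) fun φ h1 h2 h3 => ?_
    have h4 := hs.2.2 φ ⟨h1, h2, h3⟩ i
    simp only [sub_self, zero_mul, integral_zero] at h4
    rw [setIntegral_eq_of_tsupport h3 _ (fun x hx => by rw [hx, mul_zero])] at h4
    simp only [smul_eq_mul, mul_comm (φ _)]
    linarith
  rw [Filter.EventuallyEq, ae_restrict_iff' hU.measurableSet]
  filter_upwards [ae_all_iff.2 key] with x hx hxU
  ext i
  have := hx i hxU
  simpa [sub_eq_zero] using this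

theorem IsWeakGradient.weakGradient {U : Set R3} {w : R3 → ℝ} {G : R3 → R3}
    (h : IsWeakGradient U w G) : IsWeakGradient U w (weakGradient U w) := by
  have h' : ∃ G, IsWeakGradient U w G := ⟨G, h⟩
  rw [_root_.weakGradient, dif_pos h']
  exact h'.choose_spec

theorem IsWeakGradient.weakGradient_ae_eq {U : Set R3} (hU : IsOpen U) {w : R3 → ℝ} {G : R3 → R3}
    (h : IsWeakGradient U w G) : _root_.weakGradient U w =ᵐ[volume.restrict U] G :=
  h.weakGradient.ae_eq hU h

theorem weakGradient_zero_ae_eq {U : Set R3} (hU : IsOpen U) :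
    weakGradient U (fun _ => 0) =ᵐ[volume.restrict U] 0 := by
  refine IsWeakGradient.weakGradient_ae_eq hU ?_
  have := isWeakGradient_gradient (U := U) (w := fun _ => 0) contDiff_const
  rwa [gradient_fun_const'] at this

theorem MemH1.isWeakGradient {U : Set R3} {w : R3 → ℝ} (h : MemH1 U w) :
    IsWeakGradient U w (weakGradient U w) := by
  obtain ⟨_, G, hG, _⟩ := h
  exact hG.weakGradient

theorem MemH1.memLp_weakGradient {U : Set R3} (hU : IsOpen U) {w : R3 → ℝ} (h : MemH1 U w) :
    MemLp (weakGradient U w) 2 (volume.restrict U) := by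
  obtain ⟨_, G, hG, hG'⟩ := h
  exact hG'.ae_eq (hG.weakGradient_ae_eq hU).symm

theorem IsTest.memLp {U : Set R3} {φ : R3 → ℝ} (h : IsTest U φ) (p : ENNReal) (μ : Measure R3)
    [IsFiniteMeasureOnCompacts μ] : MemLp φ p μ :=
  h.1.continuous.memLp_of_hasCompactSupport h.2.1

theorem IsTest.memLp_gradient {U : Set R3} {φ : R3 → ℝ} (h : IsTest U φ) (p : ENNReal)
    (μ : Measure R3) [IsFiniteMeasureOnCompacts μ] : MemLp (gradient φ) p μ :=
  (continuous_gradient h.contDiff_one).memLp_of_hasCompactSupport h.2.1.gradient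

theorem IsTest.memH1 {U V : Set R3} {φ : R3 → ℝ} (h : IsTest V φ) : MemH1 U φ :=
  ⟨h.memLp _ _, gradient φ, isWeakGradient_gradient h.contDiff_one, h.memLp_gradient _ _⟩

theorem MemH1.sub {U : Set R3} {w w' : R3 → ℝ} (h : MemH1 U w) (h' : MemH1 U w') :
    MemH1 U (fun x => w x - w' x) := by
  obtain ⟨h0, G, h1, h2⟩ := h
  obtain ⟨h0', G', h1', h2'⟩ := h'
  exact ⟨h0.sub h0', G - G', h1.sub h1', h2.sub h2'⟩

theorem MemH10.sub_isTest {U : Set R3} {w φ : R3 → ℝ} (h : MemH10 U w) (hφ : IsTest U φ) :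
    MemH10 U (fun x => w x - φ x) := by
  refine ⟨h.1.sub hφ.memH1, fun δ hδ => ?_⟩
  obtain ⟨ψ, hψ, hlt⟩ := h.2 δ hδ
  refine ⟨_, hψ.sub hφ, ?_⟩
  convert hlt using 3
  ring

theorem MemH1.weakGradient_sub_ae_eq {U : Set R3} (hU : IsOpen U) {w φ : R3 → ℝ} (h : MemH1 U w)
    (hφ : ContDiff ℝ 1 φ) : weakGradient U (fun x => w x - φ x)
      =ᵐ[volume.restrict U] weakGradient U w - gradient φ :=
  (h.isWeakGradient.sub (isWeakGradient_gradient hφ)).weakGradient_ae_eq hU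

theorem MemH10.exists_seq {U : Set R3} (hU : IsOpen U) {w : R3 → ℝ} (h : MemH10 U w) :
    ∃ φ : ℕ → R3 → ℝ, (∀ n, IsTest U (φ n)) ∧
      Tendsto (fun n => eLpNorm (w - φ n) 2 (volume.restrict U)) atTop (𝓝 0) ∧
      Tendsto (fun n => eLpNorm (weakGradient U w - gradient (φ n)) 2 (volume.restrict U))
        atTop (𝓝 0) := by
  -- The tolerance is squared because `h1NormSq` is a squared norm.
  have hδ : ∀ n : ℕ, 0 < ((1 / ((n : ℝ) + 1)) ^ 2) := fun n =>
    pow_pos Nat.one_div_pos_of_nat 2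
  choose φ hφ hlt using fun n : ℕ => h.2 _ (hδ n)
  have hlim : Tendsto (fun n : ℕ => ENNReal.ofReal (1 / ((n : ℝ) + 1))) atTop (𝓝 0) := by
    have := ENNReal.tendsto_ofReal (tendsto_one_div_add_atTop_nhds_zero_nat (𝕜 := ℝ))
    simpa using this
  have key : ∀ n : ℕ, ∀ {E : Type} [NormedAddCommGroup E] (f : R3 → E), MemLp f 2 (volume.restrict U) →
      (∫ x in U, ‖f x‖ ^ 2) ≤ (1 / ((n : ℝ) + 1)) ^ 2 →
      eLpNorm f 2 (volume.restrict U) ≤ ENNReal.ofReal (1 / ((n : ℝ) + 1)) := by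
    intro n E _ f hf hle
    have hn : (0 : ℝ) ≤ 1 / ((n : ℝ) + 1) := by positivity
    rw [← ENNReal.pow_le_pow_left_iff (n := 2) (by norm_num), eLpNorm_two_sq_eq_ofReal hf,
      ← ENNReal.ofReal_pow hn]
    exact ENNReal.ofReal_le_ofReal hle
  refine ⟨φ, hφ, ?_, ?_⟩
  · refine tendsto_of_tendsto_of_tendsto_of_le_of_le tendsto_const_nhds hlim
      (fun _ => bot_le) fun n => key n _ (h.1.1.sub ((hφ n).memLp _ _)) ?_
    refine le_trans ?_ (hlt n).le
    simp only [h1NormSq, Pi.sub_apply, Real.norm_eq_abs, sq_abs]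
    have : 0 ≤ ∫ x in U, ‖weakGradient U (fun x => w x - φ n x) x‖ ^ 2 :=
      integral_nonneg fun x => by positivity
    linarith
  · refine tendsto_of_tendsto_of_tendsto_of_le_of_le tendsto_const_nhds hlim
      (fun _ => bot_le) fun n =>
      key n _ ((h.1.memLp_weakGradient hU).sub ((hφ n).memLp_gradient _ _)) ?_
    refine le_trans ?_ (hlt n).le
    have h1 : ∫ x in U, ‖(weakGradient U w - gradient (φ n)) x‖ ^ 2
        = ∫ x in U, ‖weakGradient U (fun x => w x - φ n x) x‖ ^ 2 := by
      refine integral_congr_ae ?_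
      filter_upwards [h.1.weakGradient_sub_ae_eq hU (hφ n).contDiff_one] with x hx
      rw [hx]
    rw [h1, h1NormSq]
    have : 0 ≤ ∫ x in U, (w x - φ n x) ^ 2 := integral_nonneg fun x => by positivity
    linarith

/-- Weak integration by parts against smooth functions that need not vanish on `∂U`. -/
theorem MemH10.integral_mul_fderiv {U : Set R3} (hU : IsOpen U) {w : R3 → ℝ} (h : MemH10 U w)
    {V : Set R3} {φ : R3 → ℝ} (hφ : IsTest V φ) (i : Fin 3) :
    ∫ x in U, w x * fderiv ℝ φ x (EuclideanSpace.single i 1)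
      = -∫ x in U, weakGradient U w x i * φ x := by
  obtain ⟨ψ, hψ, h1, h2⟩ := h.exists_seq hU
  have e1 := tendsto_integral_mul_of_tendsto_eLpNorm h.1.1
    (fun n => (hψ n).memLp 2 (volume.restrict U))
    ((hφ.memLp_gradient 2 (volume.restrict U)).eucl_apply i)
    (fun _ => (hφ.memLp_gradient 2 (volume.restrict U)).eucl_apply i) h1 (by simp)
  have hlim : Tendsto (fun n => eLpNorm ((fun x => weakGradient U w x i)
      - fun x => gradient (ψ n) x i) 2 (volume.restrict U)) atTop (𝓝 0) := by
    refine tendsto_of_tendsto_of_tendsto_of_le_of_le tendsto_const_nhds h2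
      (fun _ => bot_le) fun n => eLpNorm_mono fun x => ?_
    exact PiLp.norm_apply_le ((weakGradient U w - gradient (ψ n)) x) i
  have e2 := tendsto_integral_mul_of_tendsto_eLpNorm
    ((h.1.memLp_weakGradient hU).eucl_apply i)
    (fun n => ((hψ n).memLp_gradient 2 (volume.restrict U)).eucl_apply i)
    (hφ.memLp 2 (volume.restrict U)) (fun _ => hφ.memLp 2 (volume.restrict U)) hlim (by simp)
  simp only [gradient_apply] at e1 e2
  refine tendsto_nhds_unique e1 (e2.neg.congr fun n => ?_)
  have h3 := integral_mul_fderiv_single hφ.contDiff_one (hψ n).contDiff_one (hψ n).2.1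
    (EuclideanSpace.single i 1)
  have h4 := setIntegral_eq_of_tsupport (hψ n).2.2
    (fun x => ψ n x * fderiv ℝ φ x (EuclideanSpace.single i 1)) (fun x hx => by simp [hx])
  have h5 := setIntegral_eq_of_tsupport
    ((tsupport_fderiv_apply_le (ψ n) (EuclideanSpace.single i 1)).trans (hψ n).2.2) (fun x => fderiv ℝ (ψ n) x (EuclideanSpace.single i 1) * φ x) (fun x hx => by simp [hx])
  rw [h4, h5]
  simp only [mul_comm (φ _), mul_comm _ (ψ n _)] at h3 ⊢
  linarith

/-! ### Passing to limits in `H¹₀` -/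

/-- An estimate on test functions passes to the closure: a subsequence converges almost everywhere,
Fatou handles the left side, and the gradients converge in `L²`. Convergence in `L^p(ν)` is never
needed, so `p` may exceed `2`. -/
theorem MemH10.eLpNorm_le {U : Set R3} (hU : IsOpen U) {w : R3 → ℝ} (h : MemH10 U w)
    {p : ENNReal} {ν : Measure R3} (hν : ν ≤ volume.restrict U) {C : ENNReal} (hC : C ≠ ⊤)
    (H : ∀ φ, IsTest U φ → eLpNorm φ p ν ≤ C * eLpNorm (gradient φ) 2 (volume.restrict U)) :
    eLpNorm w p ν ≤ C * eLpNorm (weakGradient U w) 2 (volume.restrict U) := by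
  obtain ⟨φ, hφ, h1, h2⟩ := h.exists_seq hU
  have h1' : Tendsto (fun n => eLpNorm (φ n - w) 2 (volume.restrict U)) atTop (𝓝 0) :=
    h1.congr fun n => eLpNorm_sub_comm _ _ _ _
  obtain ⟨ns, hns, hae⟩ := (tendstoInMeasure_of_tendsto_eLpNorm (by norm_num)
    (fun n => ((hφ n).memLp 2 _).1) h.1.1.1 h1').exists_seq_tendsto_ae
  have hlim : Tendsto (fun n => C * (eLpNorm (weakGradient U w) 2 (volume.restrict U)
      + eLpNorm (weakGradient U w - gradient (φ (ns n))) 2 (volume.restrict U))) atTop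
      (𝓝 (C * (eLpNorm (weakGradient U w) 2 (volume.restrict U) + 0))) :=
    ENNReal.Tendsto.const_mul (tendsto_const_nhds.add (h2.comp hns.tendsto_atTop)) (Or.inr hC)
  rw [add_zero] at hlim
  calc eLpNorm w p ν ≤ liminf (fun n => eLpNorm (φ (ns n)) p ν) atTop :=
        Lp.eLpNorm_lim_le_liminf_eLpNorm (fun n => (hφ _).1.continuous.aestronglyMeasurable)
          w (ae_mono hν hae)
    _ ≤ liminf (fun n => C * (eLpNorm (weakGradient U w) 2 (volume.restrict U)
      + eLpNorm (weakGradient U w - gradient (φ (ns n))) 2 (volume.restrict U))) atTop := by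
        refine liminf_le_liminf (Eventually.of_forall fun n => ?_)
        refine (H _ (hφ _)).trans ?_
        gcongr
        have e : gradient (φ (ns n)) = weakGradient U w
            - (weakGradient U w - gradient (φ (ns n))) := by abel
        nth_rewrite 1 [e]
        have hw := (h.1.memLp_weakGradient hU).1
        exact eLpNorm_sub_le hw (hw.sub ((hφ _).memLp_gradient 2 _).1) (by norm_num)
    _ = _ := hlim.liminf_eq

theorem IsTest.eLpNorm_gradient_restrict {U : Set R3} {φ : R3 → ℝ} (h : IsTest U φ)
    (p : ENNReal) : eLpNorm (gradient φ) p (volume.restrict U) = eLpNorm (gradient φ) p volume := by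
  refine eLpNorm_restrict_eq_of_support_subset fun x hx => h.2.2 ?_
  by_contra hx'
  have : fderiv ℝ φ x = 0 :=
    image_eq_zero_of_notMem_tsupport fun h' => hx' (tsupport_fderiv_subset ℝ h')
  exact hx (by simp [gradient, this])

/-- The Sobolev inequality in dimension three, for functions in `H¹₀`. -/
theorem exists_sobolev_const : ∃ C : NNReal, ∀ (U : Set R3), IsOpen U → ∀ w : R3 → ℝ, MemH10 U w →
    eLpNorm w 6 (volume.restrict U) ≤ C * eLpNorm (weakGradient U w) 2 (volume.restrict U) := by
  refine ⟨SNormLESNormFDerivOfEqConst ℝ (volume : Measure R3) 2, fun U hU w hw =>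
    hw.eLpNorm_le hU le_rfl ENNReal.coe_ne_top fun φ hφ => ?_⟩
  -- The inequality is applied on all of `ℝ³`, which makes the constant independent of `U`.
  have h := eLpNorm_le_eLpNorm_fderiv_of_eq (volume : Measure R3) hφ.contDiff_one hφ.2.1
    (p := 2) (p' := 6) (by norm_num) (by simp) (by simp; norm_num)
  have e : eLpNorm (gradient φ) 2 volume = eLpNorm (fderiv ℝ φ) 2 volume :=
    eLpNorm_congr_norm_ae (Eventually.of_forall fun x => norm_gradient φ x)
  rw [hφ.eLpNorm_gradient_restrict, e]
  exact (eLpNorm_mono_measure _ Measure.restrict_le_self).trans h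

theorem MemH10.memLp_six {U : Set R3} (hU : IsOpen U) {w : R3 → ℝ} (h : MemH10 U w) :
    MemLp w 6 (volume.restrict U) := by
  obtain ⟨C, hC⟩ := exists_sobolev_const
  exact ⟨h.1.1.1, (hC U hU w h).trans_lt
    (ENNReal.mul_lt_top ENNReal.coe_lt_top (h.1.memLp_weakGradient hU).2)⟩

instance holderTriple_six_six_three : ENNReal.HolderTriple 6 6 3 where
  inv_add_inv_eq_inv := by
    rw [← ENNReal.toReal_eq_toReal_iff' (by simp) (by simp)]
    rw [ENNReal.toReal_add (by simp) (by simp)]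
    simp
    norm_num

/-- Used for the product `θ uᵢ`: Sobolev puts both factors in `L⁶`, so the product is in `L³`, hence
in `L²` on a bounded domain, and can be paired with `∇θ`. -/
theorem MeasureTheory.MemLp.mul_six_six {μ : Measure R3} [IsFiniteMeasure μ] {f g : R3 → ℝ}
    (hf : MemLp f 6 μ) (hg : MemLp g 6 μ) : MemLp (fun x => f x * g x) 2 μ := by
  have h : MemLp (fun x => f x * g x) 3 μ := MemLp.mul' (p := 6) (q := 6) hg hf
  exact h.mono_exponent (by norm_num)

theorem tendsto_eLpNorm_mul_six {μ : Measure R3} [IsFiniteMeasure μ] {g : R3 → ℝ}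
    {F : ℕ → R3 → ℝ} (hF : ∀ n, MemLp (F n) 6 μ) (hg : MemLp g 6 μ)
    (h : Tendsto (fun n => eLpNorm (F n) 6 μ) atTop (𝓝 0)) :
    Tendsto (fun n => eLpNorm (fun x => F n x * g x) 2 μ) atTop (𝓝 0) := by
  obtain ⟨K, hKt, hK⟩ : ∃ K : ENNReal, K ≠ ⊤ ∧ ∀ f : R3 → ℝ, AEStronglyMeasurable f μ →
      eLpNorm f 2 μ ≤ eLpNorm f 3 μ * K := by
    refine ⟨μ Set.univ ^ (1 / (2 : ENNReal).toReal - 1 / (3 : ENNReal).toReal),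
      ENNReal.rpow_ne_top_of_nonneg (by norm_num) (measure_ne_top _ _), fun f hf =>
      eLpNorm_le_eLpNorm_mul_rpow_measure_univ (by norm_num) hf⟩
  have hb : ∀ n, eLpNorm (fun x => F n x * g x) 2 μ ≤ eLpNorm (F n) 6 μ * (eLpNorm g 6 μ * K) := by
    intro n
    have h3 : AEStronglyMeasurable (fun x => F n x * g x) μ := (hF n).1.mul hg.1
    have h4 : eLpNorm (F n • g) 3 μ ≤ eLpNorm (F n) 6 μ * eLpNorm g 6 μ :=
      eLpNorm_smul_le_mul_eLpNorm (p := 6) (q := 6) (r := 3) hg.1 (hF n).1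
    have e : F n • g = fun x => F n x * g x := by ext x; rfl
    rw [e] at h4
    rw [← mul_assoc]
    exact (hK _ h3).trans (mul_le_mul_left h4 K)
  refine tendsto_of_tendsto_of_tendsto_of_le_of_le tendsto_const_nhds ?_ (fun _ => bot_le) hb
  have := ENNReal.Tendsto.mul_const h (b := eLpNorm g 6 μ * K)
    (Or.inr (ENNReal.mul_ne_top hg.2.ne hKt))
  simpa using this

theorem IsTest.sq {U : Set R3} {φ : R3 → ℝ} (h : IsTest U φ) : IsTest U (fun x => φ x ^ 2) := by
  have e : (fun x => φ x ^ 2) = fun x => φ x * φ x := by ext; ring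
  rw [e]
  exact ⟨h.1.mul h.1, h.2.1.mul_left, (tsupport_mul_subset_left).trans h.2.2⟩

theorem IsTest.fderiv_sq {U : Set R3} {φ : R3 → ℝ} (h : IsTest U φ) (x v : R3) :
    fderiv ℝ (fun x => φ x ^ 2) x v = 2 * (φ x * fderiv ℝ φ x v) := by
  have hd : HasFDerivAt φ (fderiv ℝ φ x) x :=
    (h.contDiff_one.differentiable (by norm_num) x).hasFDerivAt
  rw [(hd.pow 2).fderiv]
  simp
  ring

/-- Since `φ ∇φ = ½ ∇(φ²)`, integration by parts moves the derivative onto `u` and produces `div u`.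
No condition on `φ` at `∂W` is needed, because `u` is in `H¹₀(W)`. -/
theorem integral_mul_inner_gradient_eq_zero {W V : Set R3} (hW : IsOpen W) {u : R3 → R3}
    (hu : MemH10Vec W u) (hdiv : ∀ᵐ x ∂(volume.restrict W), weakDiv W u x = 0)
    {φ : R3 → ℝ} (hφ : IsTest V φ) :
    ∑ i : Fin 3, ∫ x in W, (φ x * u x i) * gradient φ x i = 0 := by
  have h1 : ∀ i : Fin 3, ∫ x in W, (φ x * u x i) * gradient φ x i
      = -(1 / 2) * ∫ x in W, weakGradient W (fun y => u y i) x i * φ x ^ 2 := by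
    intro i
    have h2 := (hu i).integral_mul_fderiv hW hφ.sq i
    simp only [hφ.fderiv_sq] at h2
    have h3 : ∫ x in W, u x i * (2 * (φ x * fderiv ℝ φ x (EuclideanSpace.single i 1)))
        = 2 * ∫ x in W, (φ x * u x i) * gradient φ x i := by
      rw [← integral_const_mul]
      refine integral_congr_ae (Eventually.of_forall fun x => ?_)
      simp only [gradient_apply]
      ring
    linarith
  simp only [h1]
  rw [← Finset.mul_sum, ← integral_finsetSum]
  · have : ∫ x in W, ∑ i : Fin 3, weakGradient W (fun y => u y i) x i * φ x ^ 2
        = ∫ x in W, (0 : ℝ) := by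
      refine integral_congr_ae ?_
      filter_upwards [hdiv] with x hx
      rw [← Finset.sum_mul]
      unfold weakDiv at hx
      rw [hx, zero_mul]
    rw [this]
    simp
  · intro i _
    exact (((hu i).1.memLp_weakGradient hW).eucl_apply i).integrable_mul (hφ.sq.memLp 2 _)

/-- The convection term vanishes on the diagonal for solenoidal velocities. -/
theorem integral_convection_eq_zero {W V : Set R3} (hW : IsOpen W) (hV : IsOpen V) (hWV : W ⊆ V)
    (hfin : volume V ≠ ⊤) {u : R3 → R3} (hu : MemH10Vec W u)
    (hdiv : ∀ᵐ x ∂(volume.restrict W), weakDiv W u x = 0) {θ : R3 → ℝ} (hθ : MemH10 V θ) :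
    ∫ x in W, θ x * inner ℝ (u x) (weakGradient V θ x) = 0 := by
  have hle : volume.restrict W ≤ volume.restrict V := Measure.restrict_mono hWV le_rfl
  have : IsFiniteMeasure (volume.restrict W) :=
    ⟨by simpa using (measure_mono hWV).trans_lt (lt_top_iff_ne_top.2 hfin)⟩
  obtain ⟨φ, hφ, h1, h2⟩ := hθ.exists_seq hV
  obtain ⟨C, hC⟩ := exists_sobolev_const
  have hu6 : ∀ i, MemLp (fun x => u x i) 6 (volume.restrict W) := fun i => (hu i).memLp_six hW
  have hθ6 : MemLp θ 6 (volume.restrict W) := (hθ.memLp_six hV).mono_measure hle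
  have hD : MemLp (weakGradient V θ) 2 (volume.restrict W) :=
    (hθ.1.memLp_weakGradient hV).mono_measure hle
  -- `L²` convergence of `φ n` is too weak for the cubic term; Sobolev applied to `θ - φ n` upgrades
  -- it to `L⁶`.
  have lim6 : Tendsto (fun n => eLpNorm (θ - φ n) 6 (volume.restrict W)) atTop (𝓝 0) := by
    have hb : ∀ n, eLpNorm (θ - φ n) 6 (volume.restrict W)
        ≤ C * eLpNorm (weakGradient V θ - gradient (φ n)) 2 (volume.restrict V) := by
      intro n
      have h3 := hC V hV _ (hθ.sub_isTest (hφ n))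
      rw [eLpNorm_congr_ae (hθ.1.weakGradient_sub_ae_eq hV (hφ n).contDiff_one)] at h3
      exact (eLpNorm_mono_measure _ hle).trans h3
    refine tendsto_of_tendsto_of_tendsto_of_le_of_le tendsto_const_nhds ?_ (fun _ => bot_le) hb
    simpa using ENNReal.Tendsto.const_mul h2 (Or.inr ENNReal.coe_ne_top) (a := (C : ENNReal))
  have term : ∀ i : Fin 3, Tendsto (fun n => ∫ x in W, (φ n x * u x i) * gradient (φ n) x i) atTop
      (𝓝 (∫ x in W, (θ x * u x i) * weakGradient V θ x i)) := by
    intro i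
    refine tendsto_integral_mul_of_tendsto_eLpNorm (hθ6.mul_six_six (hu6 i))
      (fun n => ((hφ n).memLp 6 _).mul_six_six (hu6 i)) (hD.eucl_apply i)
      (fun n => ((hφ n).memLp_gradient 2 _).eucl_apply i) ?_ ?_
    · refine (tendsto_eLpNorm_mul_six (fun n => hθ6.sub ((hφ n).memLp 6 _)) (hu6 i) lim6).congr
        fun n => ?_
      congr 1
      ext x
      simp only [Pi.sub_apply]
      ring
    · refine tendsto_of_tendsto_of_tendsto_of_le_of_le tendsto_const_nhds h2
        (fun _ => bot_le) fun n => (eLpNorm_mono_measure _ hle).trans' (eLpNorm_mono fun x => ?_)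
      exact PiLp.norm_apply_le ((weakGradient V θ - gradient (φ n)) x) i
  have hsum := tendsto_finsetSum Finset.univ fun i _ => term i
  have hzero : ∑ i : Fin 3, ∫ x in W, (θ x * u x i) * weakGradient V θ x i = 0 :=
    tendsto_nhds_unique hsum
      (tendsto_const_nhds.congr fun n => (integral_mul_inner_gradient_eq_zero hW hu hdiv (hφ n)).symm)
  have hint : ∀ i : Fin 3, Integrable (fun x => (θ x * u x i) * weakGradient V θ x i)
      (volume.restrict W) := fun i => (hθ6.mul_six_six (hu6 i)).integrable_mul (hD.eucl_apply i)
  rw [← integral_finsetSum _ fun i _ => hint i] at hzero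
  rw [← hzero]
  refine integral_congr_ae (Eventually.of_forall fun x => ?_)
  simp only [PiLp.inner_apply, Finset.mul_sum]
  refine Finset.sum_congr rfl fun i _ => ?_
  simp
  ring

/-! ### Extension by zero -/

/-- No surface term appears on `∂U`: functions of `H¹₀(U)` integrate by parts against test functions
of the larger set. -/
theorem MemH10.isWeakGradient_indicator {U V : Set R3} (hU : IsOpen U) (hUV : U ⊆ V) {w : R3 → ℝ}
    (h : MemH10 U w) : IsWeakGradient V (U.indicator w) (U.indicator (weakGradient U w)) := by
  refine ⟨?_, ?_, fun φ hφ i => ?_⟩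
  · exact (((memLp_indicator_iff_restrict hU.measurableSet).2 h.1.1).locallyIntegrable
      (by norm_num)).locallyIntegrableOn _
  · exact (((memLp_indicator_iff_restrict hU.measurableSet).2
      (h.1.memLp_weakGradient hU)).locallyIntegrable (by norm_num)).locallyIntegrableOn _
  · have e1 : (fun x => U.indicator w x * fderiv ℝ φ x (EuclideanSpace.single i 1))
        = U.indicator (fun x => w x * fderiv ℝ φ x (EuclideanSpace.single i 1)) := by
      ext x; by_cases hx : x ∈ U <;> simp [hx]
    have e2 : (fun x => U.indicator (weakGradient U w) x i * φ x)
        = U.indicator (fun x => weakGradient U w x i * φ x) := by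
      ext x; by_cases hx : x ∈ U <;> simp [hx]
    rw [e1, e2, setIntegral_indicator hU.measurableSet, setIntegral_indicator hU.measurableSet,
      Set.inter_eq_self_of_subset_right hUV]
    exact h.integral_mul_fderiv hU hφ i

theorem setIntegral_sq_norm_indicator {E : Type*} [NormedAddCommGroup E] {U V : Set R3}
    (hU : MeasurableSet U) (hUV : U ⊆ V) (f : R3 → E) :
    ∫ x in V, ‖U.indicator f x‖ ^ 2 = ∫ x in U, ‖f x‖ ^ 2 := by
  have e : (fun x => ‖U.indicator f x‖ ^ 2) = U.indicator fun x => ‖f x‖ ^ 2 := by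
    ext x; by_cases hx : x ∈ U <;> simp [hx]
  rw [e, setIntegral_indicator hU, Set.inter_eq_self_of_subset_right hUV]

theorem MemH10.h1NormSq_indicator {U V : Set R3} (hU : IsOpen U) (hV : IsOpen V) (hUV : U ⊆ V)
    {w : R3 → ℝ} (h : MemH10 U w) : h1NormSq V (U.indicator w) = h1NormSq U w := by
  unfold h1NormSq
  congr 1
  · simpa only [Real.norm_eq_abs, sq_abs] using
      setIntegral_sq_norm_indicator hU.measurableSet hUV w
  · rw [← setIntegral_sq_norm_indicator hU.measurableSet hUV]
    refine integral_congr_ae ?_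
    filter_upwards [(h.isWeakGradient_indicator hU hUV).weakGradient_ae_eq hV] with x hx
    rw [hx]

theorem MemH10.indicator {U V : Set R3} (hU : IsOpen U) (hV : IsOpen V) (hUV : U ⊆ V)
    {w : R3 → ℝ} (h : MemH10 U w) : MemH10 V (U.indicator w) := by
  refine ⟨⟨?_, _, h.isWeakGradient_indicator hU hUV, ?_⟩, fun δ hδ => ?_⟩
  · exact ((memLp_indicator_iff_restrict hU.measurableSet).2 h.1.1).restrict _
  · exact ((memLp_indicator_iff_restrict hU.measurableSet).2 (h.1.memLp_weakGradient hU)).restrict _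
  · obtain ⟨φ, hφ, hlt⟩ := h.2 δ hδ
    refine ⟨φ, hφ.mono hUV, ?_⟩
    have e : (fun x => U.indicator w x - φ x) = U.indicator fun x => w x - φ x := by
      ext x
      by_cases hx : x ∈ U
      · simp [hx]
      · have : φ x = 0 := image_eq_zero_of_notMem_tsupport fun h' => hx (hφ.2.2 h')
        simp [hx, this]
    rw [e, (h.sub_isTest hφ).h1NormSq_indicator hU hV hUV]
    exact hlt

theorem memH10_zero {U : Set R3} (hU : IsOpen U) : MemH10 U fun _ => 0 := by
  have h0 : IsTest U fun _ => 0 :=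
    ⟨contDiff_const, HasCompactSupport.zero, by simp [tsupport, Function.support]⟩
  refine ⟨h0.memH1, fun δ hδ => ⟨_, h0, ?_⟩⟩
  have h1 : ∫ x in U, ‖weakGradient U (fun _ => 0) x‖ ^ 2 = 0 := by
    rw [integral_congr_ae (g := fun _ => 0), integral_zero]
    filter_upwards [weakGradient_zero_ae_eq hU] with x hx
    simp [hx]
  simpa [h1NormSq, h1] using hδ

/-! ### Weighted Poincaré inequalities from supersolutions -/

/-- Expand `∫ (∂φ + g φ)² ≥ 0`; the cross term is `∫ g ∂(φ²)`, which becomes `-∫ ∂g φ²`. -/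
theorem IsTest.integral_riccati_mul_sq_le {V : Set R3} {φ : R3 → ℝ} (hφ : IsTest V φ) {g : R3 → ℝ}
    (hg : ContDiff ℝ 1 g) (v : R3) :
    ∫ x, (fderiv ℝ g x v - g x ^ 2) * φ x ^ 2 ≤ ∫ x, fderiv ℝ φ x v ^ 2 := by
  have cdg : Continuous fun x => fderiv ℝ g x v :=
    (hg.continuous_fderiv (by norm_num)).clm_apply continuous_const
  have cdφ : Continuous fun x => fderiv ℝ φ x v :=
    (hφ.contDiff_one.continuous_fderiv (by norm_num)).clm_apply continuous_const
  have cφ := hφ.1.continuous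
  have cg := hg.continuous
  have kφ : HasCompactSupport fun x => φ x ^ 2 := hφ.sq.2.1
  have kd : HasCompactSupport fun x => fderiv ℝ φ x v := hφ.2.1.fderiv_apply (𝕜 := ℝ) v
  have i1 : Integrable fun x => fderiv ℝ g x v * φ x ^ 2 :=
    (cdg.mul (cφ.pow 2)).integrable_of_hasCompactSupport kφ.mul_left
  have i2 : Integrable fun x => g x ^ 2 * φ x ^ 2 :=
    ((cg.pow 2).mul (cφ.pow 2)).integrable_of_hasCompactSupport kφ.mul_left
  have i3 : Integrable fun x => fderiv ℝ φ x v ^ 2 := by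
    refine (cdφ.pow 2).integrable_of_hasCompactSupport ?_
    simpa only [_root_.sq] using kd.mul_left
  have i4 : Integrable fun x => g x * (2 * (φ x * fderiv ℝ φ x v)) := by
    refine (cg.mul (continuous_const.mul (cφ.mul cdφ))).integrable_of_hasCompactSupport ?_
    exact (kd.mul_left.mul_left).mul_left
  have h1 := integral_mul_fderiv_single hg hφ.sq.contDiff_one hφ.sq.2.1 v
  simp only [hφ.fderiv_sq] at h1
  have h2 : 0 ≤ ∫ x, (fderiv ℝ φ x v + g x * φ x) ^ 2 := integral_nonneg fun x => sq_nonneg _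
  have e : (fun x => (fderiv ℝ φ x v + g x * φ x) ^ 2) = fun x => fderiv ℝ φ x v ^ 2
      + g x * (2 * (φ x * fderiv ℝ φ x v)) + g x ^ 2 * φ x ^ 2 := by
    ext x; ring
  have i5 : Integrable fun x => fderiv ℝ φ x v ^ 2 + g x * (2 * (φ x * fderiv ℝ φ x v)) := i3.add i4
  rw [e, integral_add i5 i2, integral_add i3 i4, h1] at h2
  simp only [sub_mul]
  rw [integral_sub i1 i2]
  linarith

/-- If `g` satisfies the Riccati inequality `div g - |g|² ≥ c 1_S`, then `c ∫_S w² ≤ ∫ |∇w|²`. -/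
theorem MemH10.mul_setIntegral_sq_le {U S : Set R3} (hU : IsOpen U) {w : R3 → ℝ} (h : MemH10 U w)
    (hSU : S ⊆ U) (hS : MeasurableSet S) {c : ℝ} (hc : 0 < c) {g : Fin 3 → R3 → ℝ}
    (hg : ∀ i, ContDiff ℝ 1 (g i))
    (h0 : ∀ x ∈ U, 0 ≤ ∑ i, (fderiv ℝ (g i) x (EuclideanSpace.single i 1) - g i x ^ 2))
    (h1 : ∀ x ∈ S, c ≤ ∑ i, (fderiv ℝ (g i) x (EuclideanSpace.single i 1) - g i x ^ 2)) :
    c * ∫ x in S, w x ^ 2 ≤ ∫ x in U, ‖weakGradient U w x‖ ^ 2 := by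
  have hle : volume.restrict S ≤ volume.restrict U := Measure.restrict_mono hSU le_rfl
  have test : ∀ φ, IsTest U φ → c * ∫ x in S, φ x ^ 2 ≤ ∫ x in U, ‖gradient φ x‖ ^ 2 := by
    intro φ hφ
    have cdg : ∀ i, Continuous fun x => fderiv ℝ (g i) x (EuclideanSpace.single i 1) := fun i =>
      ((hg i).continuous_fderiv (by norm_num)).clm_apply continuous_const
    have iV : ∀ i, Integrable fun x =>
        (fderiv ℝ (g i) x (EuclideanSpace.single i 1) - g i x ^ 2) * φ x ^ 2 := fun i =>
      (((cdg i).sub ((hg i).continuous.pow 2)).mul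
        (hφ.1.continuous.pow 2)).integrable_of_hasCompactSupport hφ.sq.2.1.mul_left
    have iφ : Integrable fun x => φ x ^ 2 := (hφ.memLp 2 volume).integrable_sq
    calc c * ∫ x in S, φ x ^ 2 = ∫ x, S.indicator (fun x => c * φ x ^ 2) x := by
          rw [integral_indicator hS, integral_const_mul]
      _ ≤ ∫ x, ∑ i, (fderiv ℝ (g i) x (EuclideanSpace.single i 1) - g i x ^ 2) * φ x ^ 2 := by
          refine integral_mono ((iφ.const_mul c).indicator hS)
            (integrable_finsetSum _ fun i _ => iV i) fun x => ?_
          simp only [← Finset.sum_mul]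
          by_cases hx : x ∈ S
          · rw [Set.indicator_of_mem hx]
            exact mul_le_mul_of_nonneg_right (h1 x hx) (sq_nonneg _)
          · rw [Set.indicator_of_notMem hx]
            by_cases hxU : x ∈ U
            · exact mul_nonneg (h0 x hxU) (sq_nonneg _)
            · rw [image_eq_zero_of_notMem_tsupport fun h' => hxU (hφ.2.2 h')]
              simp
      _ = ∑ i, ∫ x, (fderiv ℝ (g i) x (EuclideanSpace.single i 1) - g i x ^ 2) * φ x ^ 2 :=
          integral_finsetSum _ fun i _ => iV i
      _ ≤ ∑ i, ∫ x, fderiv ℝ φ x (EuclideanSpace.single i 1) ^ 2 :=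
          Finset.sum_le_sum fun i _ => hφ.integral_riccati_mul_sq_le (hg i) _
      _ = ∫ x, ‖gradient φ x‖ ^ 2 := by
          simp only [norm_sq_eq_sum, ← gradient_apply]
          exact (integral_finsetSum _ fun i _ =>
            ((hφ.memLp_gradient 2 volume).eucl_apply i).integrable_sq).symm
      _ = ∫ x in U, ‖gradient φ x‖ ^ 2 := by
          refine (setIntegral_eq_integral_of_forall_compl_eq_zero fun x hx => ?_).symm
          have : fderiv ℝ φ x = 0 := image_eq_zero_of_notMem_tsupport
            fun h' => hx (hφ.2.2 (tsupport_fderiv_subset ℝ h'))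
          simp [gradient, this]
  have hsq : Real.sqrt (1 / c) ^ 2 = 1 / c := Real.sq_sqrt (by positivity)
  have key := h.eLpNorm_le hU hle (p := 2) (C := ENNReal.ofReal (Real.sqrt (1 / c)))
    ENNReal.ofReal_ne_top fun φ hφ => by
      rw [eLpNorm_two_le_iff (hφ.memLp _ _) (hφ.memLp_gradient _ _) (Real.sqrt_nonneg _), hsq]
      simp only [Real.norm_eq_abs, sq_abs]
      rw [one_div, ← div_eq_inv_mul, le_div_iff₀' hc]
      exact test φ hφ
  rw [eLpNorm_two_le_iff (h.1.1.mono_measure hle) (h.1.memLp_weakGradient hU) (Real.sqrt_nonneg _),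
    hsq] at key
  simp only [Real.norm_eq_abs, sq_abs] at key
  rwa [one_div, ← div_eq_inv_mul, le_div_iff₀' hc] at key

theorem fderiv_apply_single (i : Fin 3) (x v : R3) : fderiv ℝ (fun y : R3 => y i) x v = v i :=
  congrArg (· v) (EuclideanSpace.proj (𝕜 := ℝ) i).fderiv

theorem contDiff_eucl_apply {n : WithTop ℕ∞} (i : Fin 3) : ContDiff ℝ n fun y : R3 => y i :=
  (EuclideanSpace.proj (𝕜 := ℝ) i).contDiff

/-- The Poincaré inequality in `H¹₀` of a bounded open set. -/
theorem MemH10.poincare {U : Set R3} (hU : IsOpen U) {w : R3 → ℝ} (h : MemH10 U w) {R : ℝ}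
    (hR : 0 < R) (hUR : ∀ x ∈ U, ‖x‖ ≤ R) :
    ∫ x in U, w x ^ 2 ≤ R ^ 2 * ∫ x in U, ‖weakGradient U w x‖ ^ 2 := by
  -- The field is `x / R²`: its divergence is `3/R²` and its squared length at most `1/R²` on `U`.
  have hV : ∀ x ∈ U, 1 / R ^ 2 ≤ ∑ i : Fin 3, (fderiv ℝ (fun y : R3 => y i * (1 / R ^ 2)) x
      (EuclideanSpace.single i 1) - (x i * (1 / R ^ 2)) ^ 2) := by
    intro x hx
    have hd : ∀ i : Fin 3, fderiv ℝ (fun y : R3 => y i * (1 / R ^ 2)) x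
        (EuclideanSpace.single i 1) = 1 / R ^ 2 := by
      intro i
      rw [fderiv_mul_const ((contDiff_eucl_apply (n := 1) i).differentiable (by norm_num) x)]
      simp [fderiv_apply_single]
    simp only [hd, mul_pow, Finset.sum_sub_distrib, ← Finset.sum_mul, ← norm_sq_eq_sum]
    have h1 : ‖x‖ ^ 2 * (1 / R ^ 2) ^ 2 ≤ R ^ 2 * (1 / R ^ 2) ^ 2 := by
      gcongr
      exact hUR x hx
    have h2 : R ^ 2 * (1 / R ^ 2) ^ 2 = 1 / R ^ 2 := by field_simp
    have h3 : 0 < 1 / R ^ 2 := by positivity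
    simp only [Finset.sum_const, Finset.card_univ, Fintype.card_fin, nsmul_eq_mul]
    push_cast
    linarith
  have key := h.mul_setIntegral_sq_le hU Set.Subset.rfl hU.measurableSet
    (c := 1 / R ^ 2) (by positivity) (g := fun i y => y i * (1 / R ^ 2))
    (fun i => (contDiff_eucl_apply i).mul contDiff_const)
    (fun x hx => le_trans (by positivity) (hV x hx)) hV
  rwa [one_div, ← div_eq_inv_mul, div_le_iff₀' (by positivity)] at key

theorem hasFDerivAt_norm_sub_sq_add_rpow (p x : R3) {r : ℝ} (hr : 0 < r) (a : ℝ) :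
    ∃ L : R3 →L[ℝ] ℝ, HasFDerivAt (fun y : R3 => (‖y - p‖ ^ 2 + r ^ 2) ^ a) L x ∧
      ∀ i : Fin 3, L (EuclideanSpace.single i 1)
        = 2 * a * (x - p) i * (‖x - p‖ ^ 2 + r ^ 2) ^ (a - 1) := by
  have h1 : HasFDerivAt (fun y : R3 => ‖y - p‖ ^ 2 + r ^ 2) _ x :=
    (((hasFDerivAt_id x).sub_const p).norm_sq).add_const (r ^ 2)
  refine ⟨_, h1.rpow_const (p := a) (Or.inl (by positivity)), fun i => ?_⟩
  simp [EuclideanSpace.inner_single_right]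
  ring

theorem contDiff_norm_sub_sq_add_rpow {n : ℕ∞} (p : R3) {r : ℝ} (hr : 0 < r) (a : ℝ) :
    ContDiff ℝ n fun y : R3 => (‖y - p‖ ^ 2 + r ^ 2) ^ a :=
  (((contDiff_id.sub contDiff_const).norm_sq ℝ).add contDiff_const).rpow_const_of_ne
    fun x => by positivity

/-- Control of the `L²` norm on a family of balls of radius `r` by `r` times the Dirichlet norm,
from the superharmonic function `1 + ∑ r (|x - p j|² + r²)^(-1/2)`. -/
theorem MemH10.setIntegral_sq_biUnion_closedBall_le {U : Set R3} (hU : IsOpen U) {w : R3 → ℝ}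
    (h : MemH10 U w) {ι : Type*} (J : Finset ι) (p : ι → R3) {r K : ℝ} (hr : 0 < r) (hK : 0 < K)
    (hJ : (⋃ k ∈ J, Metric.closedBall (p k) r) ⊆ U)
    (hKb : ∀ k ∈ J, ∀ x ∈ Metric.closedBall (p k) r,
      1 + ∑ j ∈ J, r * (‖x - p j‖ ^ 2 + r ^ 2) ^ (-(1 / 2) : ℝ) ≤ K) :
    ∫ x in ⋃ k ∈ J, Metric.closedBall (p k) r, w x ^ 2
      ≤ 11 * K * r ^ 2 * ∫ x in U, ‖weakGradient U w x‖ ^ 2 := by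
  set ψ : R3 → ℝ := fun x => 1 + ∑ j ∈ J, r * (‖x - p j‖ ^ 2 + r ^ 2) ^ (-(1 / 2) : ℝ) with hψ
  -- `N = -∇ψ`, so the Riccati field `N/ψ` is `-∇ log ψ`.
  set N : Fin 3 → R3 → ℝ := fun i x =>
    ∑ j ∈ J, r * ((x - p j) i * (‖x - p j‖ ^ 2 + r ^ 2) ^ (-(3 / 2) : ℝ)) with hN
  have hs : ∀ x j, 0 < ‖x - p j‖ ^ 2 + r ^ 2 := fun x j => by positivity
  have hψ1 : ∀ x, 1 ≤ ψ x := fun x => by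
    have : 0 ≤ ∑ j ∈ J, r * (‖x - p j‖ ^ 2 + r ^ 2) ^ (-(1 / 2) : ℝ) :=
      Finset.sum_nonneg fun j _ => by positivity
    simp only [hψ]
    linarith
  have hψ0 : ∀ x, ψ x ≠ 0 := fun x => by linarith [hψ1 x]
  have smψ : ContDiff ℝ 1 ψ := contDiff_const.add (ContDiff.sum fun j _ =>
    contDiff_const.mul (contDiff_norm_sub_sq_add_rpow (n := 1) (p j) hr _))
  have smN : ∀ i, ContDiff ℝ 1 (N i) := fun i => ContDiff.sum fun j _ =>
    contDiff_const.mul (((contDiff_eucl_apply i).comp (contDiff_id.sub contDiff_const)).mul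
      (contDiff_norm_sub_sq_add_rpow (n := 1) (p j) hr _))
  have dψ : ∀ x i, fderiv ℝ ψ x (EuclideanSpace.single i 1) = -N i x := by
    intro x i
    choose L hL hLi using fun j => hasFDerivAt_norm_sub_sq_add_rpow (p j) x hr (-(1 / 2))
    have hd : HasFDerivAt ψ (∑ j ∈ J, r • L j) x :=
      (HasFDerivAt.fun_sum fun j _ => (hL j).const_mul r).const_add 1
    rw [hd.fderiv]
    simp only [_root_.sum_apply, _root_.smul_apply, hLi, hN, smul_eq_mul,
      ← Finset.sum_neg_distrib]
    refine Finset.sum_congr rfl fun j _ => ?_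
    norm_num
    ring
  have dN : ∀ x i, fderiv ℝ (N i) x (EuclideanSpace.single i 1) = ∑ j ∈ J,
      r * ((‖x - p j‖ ^ 2 + r ^ 2) ^ (-(3 / 2) : ℝ)
        - 3 * (x - p j) i ^ 2 * (‖x - p j‖ ^ 2 + r ^ 2) ^ (-(5 / 2) : ℝ)) := by
    intro x i
    choose L hL hLi using fun j => hasFDerivAt_norm_sub_sq_add_rpow (p j) x hr (-(3 / 2))
    have hc : ∀ j, HasFDerivAt (fun y : R3 => (y - p j) i) (EuclideanSpace.proj (𝕜 := ℝ) i) x :=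
      fun j => ((EuclideanSpace.proj (𝕜 := ℝ) i).hasFDerivAt (x := x)).sub_const (p j i)
    have hd : HasFDerivAt (N i) (∑ j ∈ J, r • ((x - p j) i • L j
        + (‖x - p j‖ ^ 2 + r ^ 2) ^ (-(3 / 2) : ℝ) • EuclideanSpace.proj (𝕜 := ℝ) i)) x :=
      HasFDerivAt.fun_sum fun j _ => ((hc j).mul (hL j)).const_mul r
    rw [hd.fderiv]
    simp only [_root_.sum_apply, _root_.smul_apply,
      _root_.add_apply, hLi, smul_eq_mul]
    refine Finset.sum_congr rfl fun j _ => ?_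
    have e : (-(3 / 2) - 1 : ℝ) = -(5 / 2) := by norm_num
    rw [e]
    have e' : (EuclideanSpace.proj (𝕜 := ℝ) i : R3 →L[ℝ] ℝ) (EuclideanSpace.single i 1) = 1 := by
      simp
    rw [e']
    ring
  -- For this field `div g - |g|² = -Δψ/ψ`. With `s = |x - p|² + r²`, dimension three gives `3
  -- s^(-3/2) - 3 |x - p|² s^(-5/2) = 3 r² s^(-5/2)`, which is positive.
  have hV : ∀ x, ∑ i, (fderiv ℝ (fun y => N i y / ψ y) x (EuclideanSpace.single i 1)
      - (N i x / ψ x) ^ 2)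
      = (∑ j ∈ J, 3 * r ^ 3 * (‖x - p j‖ ^ 2 + r ^ 2) ^ (-(5 / 2) : ℝ)) / ψ x := by
    intro x
    have h1 : ∀ i, fderiv ℝ (fun y => N i y / ψ y) x (EuclideanSpace.single i 1)
        - (N i x / ψ x) ^ 2 = fderiv ℝ (N i) x (EuclideanSpace.single i 1) / ψ x := by
      intro i
      have hq := (((smN i).div smψ hψ0).differentiable (by norm_num) x).hasFDerivAt
      have hp := hq.mul (smψ.differentiable (by norm_num) x).hasFDerivAt
      -- Differentiating the product `(N/ψ) ψ = N` takes the place of the quotient rule.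
      have e : N i / ψ * ψ = N i := by
        ext y
        exact div_mul_cancel₀ _ (hψ0 y)
      have hd : fderiv ℝ (N i) x (EuclideanSpace.single i 1) = N i x / ψ x * -N i x
          + ψ x * fderiv ℝ (fun y => N i y / ψ y) x (EuclideanSpace.single i 1) := by
        rw [e] at hp
        rw [← dψ, hp.fderiv]
        rfl
      rw [hd]
      have := hψ0 x
      field_simp
      ring
    simp only [h1, dN]
    rw [← Finset.sum_div, Finset.sum_comm]
    congr 1
    refine Finset.sum_congr rfl fun j _ => ?_
    have e : (‖x - p j‖ ^ 2 + r ^ 2) ^ (-(3 / 2) : ℝ)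
        = (‖x - p j‖ ^ 2 + r ^ 2) * (‖x - p j‖ ^ 2 + r ^ 2) ^ (-(5 / 2) : ℝ) := by
      conv_rhs => rw [← Real.rpow_one_add' (hs x j).le (by norm_num)]
      norm_num
    rw [← Finset.mul_sum, Finset.sum_sub_distrib, ← Finset.sum_mul, ← Finset.mul_sum,
      ← norm_sq_eq_sum, e]
    simp only [Finset.sum_const, Finset.card_univ, Fintype.card_fin, nsmul_eq_mul]
    push_cast
    ring
  -- On a ball, the potential of its own centre suffices: `3 r³ / (2r)⁵ = 3 / (32 r²)`, and `32/3 <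
  -- 11`.
  have hc : ∀ x ∈ ⋃ k ∈ J, Metric.closedBall (p k) r, 1 / (11 * K * r ^ 2)
      ≤ ∑ i, (fderiv ℝ (fun y => N i y / ψ y) x (EuclideanSpace.single i 1)
      - (N i x / ψ x) ^ 2) := by
    intro x hx
    rw [hV]
    simp only [Set.mem_iUnion, exists_prop] at hx
    obtain ⟨k, hk, hxk⟩ := hx
    have hψK : ψ x ≤ K := hKb k hk x hxk
    have hle : ‖x - p k‖ ^ 2 + r ^ 2 ≤ (2 * r) ^ 2 := by
      have := mem_closedBall_iff_norm.1 hxk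
      nlinarith [norm_nonneg (x - p k)]
    have h1 : 1 / (2 * r) ^ 5 ≤ (‖x - p k‖ ^ 2 + r ^ 2) ^ (-(5 / 2) : ℝ) := by
      have h2 : ((2 * r) ^ 2 : ℝ) ^ (-(5 / 2) : ℝ) = 1 / (2 * r) ^ 5 := by
        rw [← Real.rpow_natCast, ← Real.rpow_mul (by positivity), ← Real.rpow_natCast,
          one_div, ← Real.rpow_neg (by positivity)]
        norm_num
      rw [← h2]
      exact Real.rpow_le_rpow_of_nonpos (hs x k) hle (by norm_num)
    have h3 : 3 * r ^ 3 * (1 / (2 * r) ^ 5)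
        ≤ ∑ j ∈ J, 3 * r ^ 3 * (‖x - p j‖ ^ 2 + r ^ 2) ^ (-(5 / 2) : ℝ) :=
      le_trans (mul_le_mul_of_nonneg_left h1 (by positivity))
        (Finset.single_le_sum (f := fun j => 3 * r ^ 3 * (‖x - p j‖ ^ 2 + r ^ 2) ^ (-(5 / 2) : ℝ))
          (fun j _ => by positivity) hk)
    have hψp : 0 < ψ x := by linarith [hψ1 x]
    calc 1 / (11 * K * r ^ 2) ≤ 3 * r ^ 3 * (1 / (2 * r) ^ 5) / K := by
          rw [div_le_div_iff₀ (by positivity) hK]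
          have : 3 * r ^ 3 * (1 / (2 * r) ^ 5) * (11 * K * r ^ 2) = 33 / 32 * K := by
            field_simp
            ring
          rw [this]
          linarith
      _ ≤ _ := div_le_div₀ (le_trans (by positivity) h3) h3 hψp hψK
  have key := h.mul_setIntegral_sq_le hU hJ
    (Finset.measurableSet_biUnion _ fun k _ => Metric.isClosed_closedBall.measurableSet)
    (c := 1 / (11 * K * r ^ 2)) (by positivity) (g := fun i y => N i y / ψ y)
    (fun i => (smN i).div smψ hψ0) (fun x _ => by
      rw [hV]
      exact div_nonneg (Finset.sum_nonneg fun j _ => by positivity) (by linarith [hψ1 x])) hc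
  rwa [one_div, ← div_eq_inv_mul, div_le_iff₀' (by positivity)] at key

/-! ### Lattice sums -/

/-- Telescoping: `1/√(1+n) ≤ 2 (√(1+n) - √n)`. -/
theorem sum_range_inv_sqrt_le (n : ℕ) :
    ∑ m ∈ Finset.range n, (Real.sqrt (1 + m))⁻¹ ≤ 2 * Real.sqrt n := by
  induction n with
  | zero => simp
  | succ n ih =>
    rw [Finset.sum_range_succ]
    refine (add_le_add_left ih _).trans ?_
    have e : ((n + 1 : ℕ) : ℝ) = 1 + n := by push_cast; ring
    rw [e]
    have h1 : 0 < Real.sqrt (1 + n) := Real.sqrt_pos.2 (by positivity)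
    have h2 : 0 ≤ Real.sqrt n := Real.sqrt_nonneg _
    have h3 : Real.sqrt (1 + n) ^ 2 = 1 + n := Real.sq_sqrt (by positivity)
    have h4 : Real.sqrt n ^ 2 = n := Real.sq_sqrt (by positivity)
    have h5 : (Real.sqrt (1 + n))⁻¹ * Real.sqrt (1 + n) = 1 := inv_mul_cancel₀ h1.ne'
    nlinarith [sq_nonneg (Real.sqrt (1 + n) - Real.sqrt n)]

/-- Each distance to `k` is attained by at most two integers `j`, which doubles the one-sided bound.
-/
theorem sum_Icc_inv_sqrt_natAbs_le {M : ℕ} {k : ℤ} (hk : k ∈ Finset.Icc (-(M : ℤ)) M) :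
    ∑ j ∈ Finset.Icc (-(M : ℤ)) M, (Real.sqrt (1 + (k - j).natAbs))⁻¹
      ≤ 4 * Real.sqrt (2 * M + 1) := by
  have hmap : ∀ j ∈ Finset.Icc (-(M : ℤ)) M, (k - j).natAbs ∈ Finset.range (2 * M + 1) := by
    intro j hj
    simp only [Finset.mem_Icc, Finset.mem_range] at *
    omega
  rw [← Finset.sum_fiberwise_of_maps_to hmap]
  have h1 : ∀ m ∈ Finset.range (2 * M + 1),
      ∑ j ∈ Finset.Icc (-(M : ℤ)) M with (k - j).natAbs = m, (Real.sqrt (1 + (k - j).natAbs))⁻¹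
        ≤ 2 * (Real.sqrt (1 + m))⁻¹ := by
    intro m _
    rw [Finset.sum_congr rfl (g := fun _ => (Real.sqrt (1 + m))⁻¹)
      (fun j hj => by rw [(Finset.mem_filter.1 hj).2]), Finset.sum_const, nsmul_eq_mul]
    refine mul_le_mul_of_nonneg_right ?_ (by positivity)
    have hsub : (Finset.Icc (-(M : ℤ)) M).filter (fun j => (k - j).natAbs = m)
        ⊆ {k - m, k + m} := by
      intro j hj
      have := (Finset.mem_filter.1 hj).2
      simp only [Finset.mem_insert, Finset.mem_singleton]
      omega
    exact_mod_cast (Finset.card_le_card hsub).trans Finset.card_le_two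
  refine (Finset.sum_le_sum h1).trans ?_
  rw [← Finset.mul_sum]
  have := sum_range_inv_sqrt_le (2 * M + 1)
  push_cast at this
  linarith

/-- The indices `k ∈ ℤ³` with all coordinates at most `M` in absolute value. -/
noncomputable def latticeBox (M : ℕ) : Finset (Fin 3 → ℤ) :=
  Fintype.piFinset fun _ => Finset.Icc (-(M : ℤ)) M

theorem card_latticeBox (M : ℕ) : (latticeBox M).card = (2 * M + 1) ^ 3 := by
  have h : ((M : ℤ) + 1 + M).toNat = 2 * M + 1 := by omega
  simp [latticeBox, Fintype.card_piFinset, h]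

/-- The summand is a product over coordinates, constant in the third. With `n = 2M + 1` the factors
are at most `4√n`, `4√n` and `n`; the order `M²` is that of the Newtonian lattice sum. -/
theorem sum_latticeBox_le {M : ℕ} {k : Fin 3 → ℤ} (hk : k ∈ latticeBox M) :
    ∑ j ∈ latticeBox M, (Real.sqrt (1 + (k 0 - j 0).natAbs))⁻¹
      * (Real.sqrt (1 + (k 1 - j 1).natAbs))⁻¹ ≤ 16 * (2 * M + 1) ^ 2 := by
  have hk' := Fintype.mem_piFinset.1 hk
  set F : Fin 3 → ℤ → ℝ := ![fun j => (Real.sqrt (1 + (k 0 - j).natAbs))⁻¹,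
    fun j => (Real.sqrt (1 + (k 1 - j).natAbs))⁻¹, fun _ => 1] with hF
  have h1 := Finset.prod_univ_sum (fun _ : Fin 3 => Finset.Icc (-(M : ℤ)) M) F
  simp only [Fin.prod_univ_three] at h1
  have h2 : ∑ j ∈ latticeBox M, (Real.sqrt (1 + (k 0 - j 0).natAbs))⁻¹
      * (Real.sqrt (1 + (k 1 - j 1).natAbs))⁻¹
      = ∑ j ∈ latticeBox M, F 0 (j 0) * F 1 (j 1) * F 2 (j 2) := by
    simp [hF]
  rw [h2]
  unfold latticeBox
  rw [← h1]
  have hc : ∑ j ∈ Finset.Icc (-(M : ℤ)) M, F 2 j = 2 * M + 1 := by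
    have h : ((M : ℤ) + 1 + M).toNat = 2 * M + 1 := by omega
    simp [hF, h]
  rw [hc]
  have a0 := sum_Icc_inv_sqrt_natAbs_le (hk' 0)
  have a1 := sum_Icc_inv_sqrt_natAbs_le (hk' 1)
  have hs : Real.sqrt (2 * M + 1) ^ 2 = 2 * M + 1 := Real.sq_sqrt (by positivity)
  calc (∑ j ∈ Finset.Icc (-(M : ℤ)) M, F 0 j) * (∑ j ∈ Finset.Icc (-(M : ℤ)) M, F 1 j)
        * (2 * M + 1)
      ≤ (4 * Real.sqrt (2 * M + 1)) * (4 * Real.sqrt (2 * M + 1)) * (2 * M + 1) := by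
        gcongr
        · exact Finset.sum_nonneg fun j _ => inv_nonneg.2 (Real.sqrt_nonneg _)
        · exact a0
        · exact a1
    _ = 16 * Real.sqrt (2 * M + 1) ^ 2 * (2 * M + 1) := by ring
    _ = _ := by rw [hs]; ring

/-! ### The geometry of the suspensions -/

theorem latticePoint_mem_cell (ε : ℝ) (k : Fin 3 → ℤ) : latticePoint ε k ∈ cell ε k :=
  ⟨0, fun i => by norm_num, by simp⟩

theorem closedBall_subset_cell {ε ρ : ℝ} (hε : 0 < ε) (hρ : ρ < ε / 2) (k : Fin 3 → ℤ) :
    Metric.closedBall (latticePoint ε k) ρ ⊆ cell ε k := by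
  intro x hx
  refine ⟨ε⁻¹ • (x - latticePoint ε k), fun i => ?_, ?_⟩
  · have h1 : |(x - latticePoint ε k) i| < ε / 2 :=
      ((PiLp.norm_apply_le (x - latticePoint ε k) i).trans (mem_closedBall_iff_norm.1 hx)).trans_lt
        hρ
    rw [abs_lt] at h1
    have h2 : (ε⁻¹ • (x - latticePoint ε k)) i = (x - latticePoint ε k) i / ε := by
      simp only [PiLp.smul_apply, smul_eq_mul]
      ring
    rw [h2, lt_div_iff₀ hε, div_lt_iff₀ hε]
    constructor <;> linarith [h1.1, h1.2]
  · simp only [smul_inv_smul₀ hε.ne']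
    abel

theorem solid_subset {Ω : Set R3} {ε ρ : ℝ} (hε : 0 < ε) (hρ : ρ < ε / 2) : solid Ω ε ρ ⊆ Ω :=
  Set.iUnion₂_subset fun k hk => (closedBall_subset_cell hε hρ k).trans hk

theorem cellIndices_subset_latticeBox {Ω : Set R3} {R ε : ℝ} (hΩR : ∀ x ∈ Ω, ‖x‖ ≤ R)
    (hε : 0 < ε) : cellIndices Ω ε ⊆ latticeBox ⌊R / ε⌋₊ := by
  intro k hk
  have h1 : ‖latticePoint ε k‖ ≤ R := hΩR _ (hk (latticePoint_mem_cell ε k))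
  refine Finset.mem_coe.2 (Fintype.mem_piFinset.2 fun i => ?_)
  have h2 : |ε * (k i : ℝ)| ≤ R := (PiLp.norm_apply_le (latticePoint ε k) i).trans h1
  rw [abs_mul, abs_of_pos hε, ← le_div_iff₀' hε] at h2
  have h3 : (k i).natAbs ≤ ⌊R / ε⌋₊ := by
    refine Nat.le_floor ?_
    rwa [Nat.cast_natAbs, Int.cast_abs]
  rw [Finset.mem_Icc]
  omega

theorem exists_finset_cellIndices {Ω : Set R3} {R ε : ℝ} (hΩR : ∀ x ∈ Ω, ‖x‖ ≤ R) (hε : 0 < ε) :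
    ∃ J : Finset (Fin 3 → ℤ), J ⊆ latticeBox ⌊R / ε⌋₊ ∧
      ∀ ρ, solid Ω ε ρ = ⋃ k ∈ J, Metric.closedBall (latticePoint ε k) ρ := by
  have hsub := cellIndices_subset_latticeBox hΩR hε
  have hfin : (cellIndices Ω ε).Finite := (Finset.finite_toSet _).subset hsub
  exact ⟨hfin.toFinset, fun k hk => hsub (hfin.mem_toFinset.1 hk), fun ρ => by simp [solid]⟩

theorem isClosed_solid {Ω : Set R3} (hΩ : Bornology.IsBounded Ω) {ε : ℝ} (hε : 0 < ε) (ρ : ℝ) :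
    IsClosed (solid Ω ε ρ) := by
  obtain ⟨R, hR⟩ := hΩ.exists_norm_le
  obtain ⟨J, _, hJ⟩ := exists_finset_cellIndices hR hε
  rw [hJ]
  exact J.finite_toSet.isClosed_biUnion fun k _ => Metric.isClosed_closedBall

theorem isOpen_fluid {Ω : Set R3} (hΩo : IsOpen Ω) (hΩ : Bornology.IsBounded Ω) {ε : ℝ}
    (hε : 0 < ε) (ρ : ℝ) : IsOpen (fluid Ω ε ρ) :=
  hΩo.sdiff (isClosed_solid hΩ hε ρ)

theorem floor_bound {R ε : ℝ} (hε : 0 < ε) (hεR : ε ≤ R) : 2 * (⌊R / ε⌋₊ : ℝ) + 1 ≤ 3 * R / ε := by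
  have h1 : (⌊R / ε⌋₊ : ℝ) ≤ R / ε := Nat.floor_le (div_nonneg (hε.le.trans hεR) hε.le)
  have h2 : 1 ≤ R / ε := by rwa [le_div_iff₀ hε, one_mul]
  have h3 : 3 * R / ε = 3 * (R / ε) := by ring
  linarith

theorem volume_real_solid_le {Ω : Set R3} {R ε ρ : ℝ} (hΩR : ∀ x ∈ Ω, ‖x‖ ≤ R) (hε : 0 < ε)
    (hεR : ε ≤ R) (hρ : 0 < ρ) : volume.real (solid Ω ε ρ)
      ≤ (3 * R / ε) ^ 3 * (ρ ^ 3 * volume.real (Metric.ball (0 : R3) 1)) := by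
  obtain ⟨J, hJb, hJ⟩ := exists_finset_cellIndices hΩR hε
  have hball : ∀ k, volume.real (Metric.closedBall (latticePoint ε k) ρ)
      = ρ ^ 3 * volume.real (Metric.ball (0 : R3) 1) := by
    intro k
    rw [measureReal_def, Measure.addHaar_closedBall _ _ hρ.le, ENNReal.toReal_mul,
      ENNReal.toReal_ofReal (by positivity), measureReal_def]
    simp
  rw [hJ]
  refine (measureReal_biUnion_finset_le J _).trans ?_
  simp only [hball, Finset.sum_const, nsmul_eq_mul]
  refine mul_le_mul_of_nonneg_right ?_ (by positivity)
  have hc : (J.card : ℝ) ≤ (2 * (⌊R / ε⌋₊ : ℝ) + 1) ^ 3 := by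
    have := Finset.card_le_card hJb
    rw [card_latticeBox] at this
    exact_mod_cast this
  exact hc.trans (pow_le_pow_left₀ (by positivity) (floor_bound hε hεR) 3)

/-- The distance `D` dominates each coordinate gap, and `j ≠ k` keeps it of order at least `ε`.
Hence `D` is at least `ε/4` times both `1 + m` and `1 + n`; multiplying the two bounds yields a
kernel that separates variables. -/
theorem rpow_latticePoint_le {ε ρ : ℝ} (hε : 0 < ε) (hρ : 0 < ρ) (hρε : ρ ≤ ε / 4)
    {k j : Fin 3 → ℤ} (hkj : j ≠ k) {x : R3} (hx : x ∈ Metric.closedBall (latticePoint ε k) ρ) :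
    (‖x - latticePoint ε j‖ ^ 2 + ρ ^ 2) ^ (-(1 / 2) : ℝ)
      ≤ 4 / ε * ((Real.sqrt (1 + (k 0 - j 0).natAbs))⁻¹
        * (Real.sqrt (1 + (k 1 - j 1).natAbs))⁻¹) := by
  set D := ‖x - latticePoint ε j‖ with hD
  have hcoord : ∀ i, ε * ((k i - j i).natAbs : ℝ) ≤ D + ρ := by
    intro i
    have h1 : ‖latticePoint ε k - latticePoint ε j‖ ≤ ρ + D := by
      have h2 := norm_sub_le_norm_sub_add_norm_sub (latticePoint ε k) x (latticePoint ε j)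
      have h3 := mem_closedBall_iff_norm'.1 hx
      linarith
    have h4 := PiLp.norm_apply_le (latticePoint ε k - latticePoint ε j) i
    have h5 : (latticePoint ε k - latticePoint ε j) i = ε * ((k i - j i : ℤ) : ℝ) := by
      simp [latticePoint]
      ring
    rw [h5, Real.norm_eq_abs, abs_mul, abs_of_pos hε, ← Int.cast_abs, ← Nat.cast_natAbs] at h4
    linarith
  obtain ⟨i, hi⟩ := Function.ne_iff.1 hkj
  have hone : ε ≤ D + ρ := by
    refine le_trans ?_ (hcoord i)
    have : 1 ≤ (k i - j i).natAbs := by omega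
    have : (1 : ℝ) ≤ (k i - j i).natAbs := by exact_mod_cast this
    nlinarith
  set m : ℝ := ((k 0 - j 0).natAbs : ℝ) with hm
  set n : ℝ := ((k 1 - j 1).natAbs : ℝ) with hn
  have hm0 : 0 ≤ m := Nat.cast_nonneg _
  have hn0 : 0 ≤ n := Nat.cast_nonneg _
  have hm1 : ε / 4 * (1 + m) ≤ D := by linarith [hcoord 0]
  have hn1 : ε / 4 * (1 + n) ≤ D := by linarith [hcoord 1]
  have hle : (ε / 4) ^ 2 * ((1 + m) * (1 + n)) ≤ D ^ 2 + ρ ^ 2 := by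
    have := mul_le_mul hm1 hn1 (by positivity) (norm_nonneg _)
    nlinarith [sq_nonneg ρ]
  refine (Real.rpow_le_rpow_of_nonpos (by positivity) hle (by norm_num)).trans (le_of_eq ?_)
  rw [Real.rpow_neg (by positivity), ← Real.sqrt_eq_rpow, Real.sqrt_mul (by positivity),
    Real.sqrt_sq (by positivity), Real.sqrt_mul (by positivity), mul_inv, mul_inv, inv_div]

/-- The critical scaling enters here: the other balls contribute at most `(4ρ/ε) · 16 (3R/ε)²`, a
multiple of `ρ/ε³`. The constant `2` is the initial `1` plus the ball's own potential. -/
theorem one_add_sum_latticePoint_le {R ε ρ : ℝ} (hε : 0 < ε) (hεR : ε ≤ R) (hρ : 0 < ρ)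
    (hρε : ρ ≤ ε / 4) {J : Finset (Fin 3 → ℤ)} (hJ : J ⊆ latticeBox ⌊R / ε⌋₊) {k : Fin 3 → ℤ}
    (hk : k ∈ J) {x : R3} (hx : x ∈ Metric.closedBall (latticePoint ε k) ρ) :
    1 + ∑ j ∈ J, ρ * (‖x - latticePoint ε j‖ ^ 2 + ρ ^ 2) ^ (-(1 / 2) : ℝ)
      ≤ 2 + 576 * R ^ 2 * (ρ / ε ^ 3) := by
  set A : (Fin 3 → ℤ) → ℝ := fun j => (Real.sqrt (1 + (k 0 - j 0).natAbs))⁻¹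
    * (Real.sqrt (1 + (k 1 - j 1).natAbs))⁻¹ with hA
  have hA0 : ∀ j, 0 ≤ A j := fun j => by positivity
  have hself : ρ * (‖x - latticePoint ε k‖ ^ 2 + ρ ^ 2) ^ (-(1 / 2) : ℝ) ≤ 1 := by
    have h1 : (‖x - latticePoint ε k‖ ^ 2 + ρ ^ 2) ^ (-(1 / 2) : ℝ)
        ≤ (ρ ^ 2) ^ (-(1 / 2) : ℝ) :=
      Real.rpow_le_rpow_of_nonpos (by positivity) (by nlinarith [sq_nonneg ‖x - latticePoint ε k‖])
        (by norm_num)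
    rw [Real.rpow_neg (by positivity), Real.rpow_neg (by positivity), ← Real.sqrt_eq_rpow,
      ← Real.sqrt_eq_rpow, Real.sqrt_sq hρ.le] at h1
    rw [Real.rpow_neg (by positivity), ← Real.sqrt_eq_rpow]
    calc _ ≤ ρ * ρ⁻¹ := by gcongr
      _ = 1 := mul_inv_cancel₀ hρ.ne'
  rw [← Finset.add_sum_erase J _ hk]
  have hrest : ∑ j ∈ J.erase k, ρ * (‖x - latticePoint ε j‖ ^ 2 + ρ ^ 2) ^ (-(1 / 2) : ℝ)
      ≤ 576 * R ^ 2 * (ρ / ε ^ 3) := by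
    calc ∑ j ∈ J.erase k, ρ * (‖x - latticePoint ε j‖ ^ 2 + ρ ^ 2) ^ (-(1 / 2) : ℝ)
        ≤ ∑ j ∈ J.erase k, ρ * (4 / ε * A j) := by
          refine Finset.sum_le_sum fun j hj => ?_
          gcongr
          exact rpow_latticePoint_le hε hρ hρε (Finset.ne_of_mem_erase hj) hx
      _ ≤ ∑ j ∈ latticeBox ⌊R / ε⌋₊, ρ * (4 / ε * A j) :=
          Finset.sum_le_sum_of_subset_of_nonneg ((Finset.erase_subset _ _).trans hJ)
            fun j _ _ => mul_nonneg hρ.le (mul_nonneg (by positivity) (hA0 j))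
      _ = ρ * (4 / ε) * ∑ j ∈ latticeBox ⌊R / ε⌋₊, A j := by
          rw [Finset.mul_sum]
          exact Finset.sum_congr rfl fun j _ => by ring
      _ ≤ ρ * (4 / ε) * (16 * (3 * R / ε) ^ 2) := by
          gcongr
          refine (sum_latticeBox_le (hJ hk)).trans ?_
          gcongr
          exact floor_bound hε hεR
      _ = 576 * R ^ 2 * (ρ / ε ^ 3) := by
          field_simp
          ring
  linarith

/-- The `L²` norm on the suspensions is controlled by `ρ` times the Dirichlet norm. -/
theorem MemH10.setIntegral_sq_solid_le {Ω : Set R3} (hΩ : IsOpen Ω) {R ε ρ : ℝ}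
    (hΩR : ∀ x ∈ Ω, ‖x‖ ≤ R) (hε : 0 < ε) (hεR : ε ≤ R) (hρ : 0 < ρ) (hρε : ρ ≤ ε / 4) {γ : ℝ}
    (hγ : ρ / ε ^ 3 ≤ γ) {w : R3 → ℝ} (h : MemH10 Ω w) :
    ∫ x in solid Ω ε ρ, w x ^ 2
      ≤ 11 * (2 + 576 * R ^ 2 * γ) * ρ ^ 2 * ∫ x in Ω, ‖weakGradient Ω w x‖ ^ 2 := by
  obtain ⟨J, hJb, hJ⟩ := exists_finset_cellIndices hΩR hε
  have hsub : solid Ω ε ρ ⊆ Ω := solid_subset hε (by linarith)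
  have hγ0 : 0 ≤ γ := le_trans (by positivity) hγ
  rw [hJ] at hsub ⊢
  refine h.setIntegral_sq_biUnion_closedBall_le hΩ J _ hρ (by positivity) hsub fun k hk x hx => ?_
  refine (one_add_sum_latticePoint_le hε hεR hρ hρε hJb hk hx).trans ?_
  gcongr

/-! ### Energy identities -/

theorem memV_zero {Ω : Set R3} {ε ρ : ℝ} (hW : IsOpen (fluid Ω ε ρ)) : MemV Ω ε ρ fun _ => 0 := by
  refine ⟨fun i => ?_, ?_⟩
  · simpa using memH10_zero hW
  · filter_upwards [weakGradient_zero_ae_eq hW] with x hx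
    simp [weakDiv, hx]

theorem IsSolution.temperature_energy {Ω : Set R3} (hΩ : IsOpen Ω) (hfin : volume Ω ≠ ⊤)
    {a b α ε ρ : ℝ} (hW : IsOpen (fluid Ω ε ρ)) {f g : R3 → ℝ} {u : R3 → R3} {θ : R3 → ℝ}
    (h : IsSolution Ω a b α ε ρ f g u θ) :
    (∫ x in fluid Ω ε ρ, ‖weakGradient Ω θ x‖ ^ 2)
        + b * (ε / ρ) ^ 3 * (∫ x in solid Ω ε ρ, ‖weakGradient Ω θ x‖ ^ 2)
      = sourceF Ω b ε ρ f g θ := by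
  have h1 := h.2.2 (fun _ => 0) θ (memV_zero hW) h.2.1
  have h2 : ∫ x in fluid Ω ε ρ, ∑ i : Fin 3,
      inner ℝ (weakGradient (fluid Ω ε ρ) (fun y => u y i) x)
        (weakGradient (fluid Ω ε ρ) (fun _ => (0 : R3) i) x) = 0 := by
    rw [integral_congr_ae (g := fun _ => 0), integral_zero]
    filter_upwards [weakGradient_zero_ae_eq hW] with x hx
    simp [hx]
  have h3 := integral_convection_eq_zero hW hΩ Set.sdiff_subset hfin h.1.1 h.1.2 h.2.1
  unfold pairG at h1
  rw [h2, h3] at h1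
  simpa [real_inner_self_eq_norm_sq] using h1

theorem IsSolution.velocity_energy {Ω : Set R3} (hΩ : IsOpen Ω) {a b α ε ρ : ℝ} (hα : 0 < α)
    (hW : IsOpen (fluid Ω ε ρ)) (hT : solid Ω ε ρ ⊆ Ω) {f g : R3 → ℝ} {u : R3 → R3} {θ : R3 → ℝ}
    (h : IsSolution Ω a b α ε ρ f g u θ) :
    ∑ i : Fin 3, ∫ x in fluid Ω ε ρ, ‖weakGradient (fluid Ω ε ρ) (fun y => u y i) x‖ ^ 2
      = a * ∫ x in fluid Ω ε ρ, θ x * u x 2 := by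
  have h1 := h.2.2 u (fun _ => 0) h.1 (memH10_zero hΩ)
  have h0 : ∀ S ⊆ Ω, ∫ x in S, inner ℝ (weakGradient Ω θ x) (weakGradient Ω (fun _ => 0) x)
      = (0 : ℝ) := by
    intro S hS
    rw [integral_congr_ae (g := fun _ => 0), integral_zero]
    filter_upwards [ae_mono (Measure.restrict_mono hS le_rfl) (weakGradient_zero_ae_eq hΩ)]
      with x hx
    simp [hx]
  have h2 : ∫ x in fluid Ω ε ρ, ∑ i : Fin 3,
      inner ℝ (weakGradient (fluid Ω ε ρ) (fun y => u y i) x)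
        (weakGradient (fluid Ω ε ρ) (fun y => u y i) x)
      = ∑ i : Fin 3, ∫ x in fluid Ω ε ρ, ‖weakGradient (fluid Ω ε ρ) (fun y => u y i) x‖ ^ 2 := by
    simp only [real_inner_self_eq_norm_sq]
    exact integral_finsetSum _ fun i _ =>
      (memLp_two_iff_integrable_sq_norm ((h.1.1 i).1.memLp_weakGradient hW).1).1
        ((h.1.1 i).1.memLp_weakGradient hW)
  unfold pairG sourceF at h1
  rw [h2, h0 (fluid Ω ε ρ) Set.sdiff_subset, h0 _ hT] at h1
  simp only [zero_mul, mul_zero, integral_zero, add_zero, mul_assoc α, ← mul_sub] at h1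
  -- Both remaining terms carry the factor `α`, so the identity does not depend on it.
  have h3 := (mul_eq_zero.1 h1).resolve_left hα.ne'
  linarith

/-! ### A priori estimates -/

theorem le_of_sq_le_mul {E C : ℝ} (hC : 0 ≤ C) (h : E ^ 2 ≤ C * E) : E ≤ C := by
  by_contra! hlt
  nlinarith

theorem sq_setIntegral_mul_le {Ω S : Set R3} (hS : S ⊆ Ω) (hfin : volume Ω ≠ ⊤) {f w : R3 → ℝ}
    (hf : Continuous f) {B : ℝ} (hB : ∀ x, ‖f x‖ ≤ B) (hw : MemLp w 2 (volume.restrict S)) :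
    (∫ x in S, f x * w x) ^ 2 ≤ B ^ 2 * volume.real S * ∫ x in S, w x ^ 2 := by
  have : IsFiniteMeasure (volume.restrict S) :=
    ⟨by simpa using (measure_mono hS).trans_lt (lt_top_iff_ne_top.2 hfin)⟩
  have hfL : MemLp f 2 (volume.restrict S) :=
    MemLp.of_bound hf.aestronglyMeasurable B (Eventually.of_forall hB)
  refine (sq_integral_mul_le hfL hw).trans
    (mul_le_mul_of_nonneg_right ?_ (integral_nonneg fun x => sq_nonneg _))
  have h1 : ∫ x in S, f x ^ 2 ≤ ∫ x in S, B ^ 2 :=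
    integral_mono hfL.integrable_sq (integrable_const _) fun x => by
      have := pow_le_pow_left₀ (norm_nonneg _) (hB x) 2
      simpa using this
  refine h1.trans (le_of_eq ?_)
  rw [integral_const, smul_eq_mul, measureReal_restrict_apply_univ, mul_comm]

theorem IsSolution.temperature_bound {Ω : Set R3} (hΩ : IsOpen Ω) (hfin : volume Ω ≠ ⊤)
    {a b α ε ρ R γ Bf Bg : ℝ} (hΩR : ∀ x ∈ Ω, ‖x‖ ≤ R) (hb : 0 < b) (hε : 0 < ε) (hεR : ε ≤ R)
    (hρ : 0 < ρ) (hρε : ρ ≤ ε / 4) (hγ : 0 < γ) (hγu : ρ / ε ^ 3 ≤ 2 * γ)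
    (hγl : γ / 2 ≤ ρ / ε ^ 3) (hβ : 1 ≤ b * (ε / ρ) ^ 3)
    (hW : IsOpen (fluid Ω ε ρ)) {f g : R3 → ℝ} (hf : Continuous f) (hg : Continuous g)
    (hBf : ∀ x, ‖f x‖ ≤ Bf) (hBg : ∀ x, ‖g x‖ ≤ Bg) {u : R3 → R3} {θ : R3 → ℝ}
    (h : IsSolution Ω a b α ε ρ f g u θ) :
    (∫ x in Ω, ‖weakGradient Ω θ x‖ ^ 2) ≤ (∫ x in fluid Ω ε ρ, ‖weakGradient Ω θ x‖ ^ 2)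
        + b * (ε / ρ) ^ 3 * (∫ x in solid Ω ε ρ, ‖weakGradient Ω θ x‖ ^ 2) ∧
    (∫ x in fluid Ω ε ρ, ‖weakGradient Ω θ x‖ ^ 2)
        + b * (ε / ρ) ^ 3 * (∫ x in solid Ω ε ρ, ‖weakGradient Ω θ x‖ ^ 2)
      ≤ 2 * (Bf ^ 2 * volume.real Ω * R ^ 2 + b ^ 2 * Bg ^ 2 * (27 * R ^ 3)
        * volume.real (Metric.ball (0 : R3) 1) * (11 * (2 + 576 * R ^ 2 * (2 * γ))) * (2 / γ)) := by
  have hR : 0 < R := hε.trans_le hεR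
  have hT : solid Ω ε ρ ⊆ Ω := solid_subset hε (by linarith)
  have hWΩ : fluid Ω ε ρ ⊆ Ω := Set.sdiff_subset
  have hen := h.temperature_energy hΩ hfin hW
  have hD := h.2.1.1.memLp_weakGradient hΩ
  have hθ : MemLp θ 2 (volume.restrict Ω) := h.2.1.1.1
  have hDi : IntegrableOn (fun x => ‖weakGradient Ω θ x‖ ^ 2) Ω :=
    (memLp_two_iff_integrable_sq_norm hD.1).1 hD
  have hTm : MeasurableSet (solid Ω ε ρ) := by
    have e : solid Ω ε ρ = Ω \ fluid Ω ε ρ := by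
      rw [fluid, Set.sdiff_sdiff_cancel_left hT]
    rw [e]
    exact hΩ.measurableSet.diff hW.measurableSet
  have hsplit : (∫ x in fluid Ω ε ρ, ‖weakGradient Ω θ x‖ ^ 2)
      = (∫ x in Ω, ‖weakGradient Ω θ x‖ ^ 2) - ∫ x in solid Ω ε ρ, ‖weakGradient Ω θ x‖ ^ 2 :=
    setIntegral_sdiff hTm hDi hT
  have hT0 : 0 ≤ ∫ x in solid Ω ε ρ, ‖weakGradient Ω θ x‖ ^ 2 :=
    integral_nonneg fun x => by positivity
  set β := b * (ε / ρ) ^ 3 with hβdef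
  set G := ∫ x in Ω, ‖weakGradient Ω θ x‖ ^ 2 with hG
  set E := (∫ x in fluid Ω ε ρ, ‖weakGradient Ω θ x‖ ^ 2)
    + β * ∫ x in solid Ω ε ρ, ‖weakGradient Ω θ x‖ ^ 2 with hE
  -- Uses `β ≥ 1`.
  have hGE : G ≤ E := by rw [hE, hsplit]; nlinarith
  have hG0 : 0 ≤ G := integral_nonneg fun x => by positivity
  refine ⟨hGE, ?_⟩
  set K := 11 * (2 + 576 * R ^ 2 * (2 * γ)) with hK
  set v := volume.real (Metric.ball (0 : R3) 1) with hv
  have hfluid : (∫ x in fluid Ω ε ρ, f x * θ x) ^ 2 ≤ Bf ^ 2 * volume.real Ω * R ^ 2 * G := by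
    have hΩθ : ∫ x in fluid Ω ε ρ, θ x ^ 2 ≤ R ^ 2 * G :=
      (setIntegral_mono_set hθ.integrable_sq (Eventually.of_forall fun x => sq_nonneg _)
        hWΩ.eventuallyLE).trans (h.2.1.poincare hΩ hR hΩR)
    have hvol : volume.real (fluid Ω ε ρ) ≤ volume.real Ω := measureReal_mono hWΩ hfin
    calc _ ≤ Bf ^ 2 * volume.real (fluid Ω ε ρ) * ∫ x in fluid Ω ε ρ, θ x ^ 2 :=
          sq_setIntegral_mul_le hWΩ hfin hf hBf (hθ.mono_measure (Measure.restrict_mono hWΩ le_rfl))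
      _ ≤ Bf ^ 2 * volume.real Ω * (R ^ 2 * G) := by gcongr
      _ = _ := by ring
  -- Power count: `β² ~ (ε/ρ)⁶`, `|T_ε| ≲ (ρ/ε)³` and `∫_{T_ε} θ² ≲ ρ² G` multiply to `ε³/ρ`,
  -- bounded by the lower bound on `ρ/ε³`.
  have hsolid : (β * ∫ x in solid Ω ε ρ, g x * θ x) ^ 2
      ≤ b ^ 2 * Bg ^ 2 * (27 * R ^ 3) * v * K * (2 / γ) * G := by
    have hq : ε ^ 3 / ρ ≤ 2 / γ := by
      rw [div_le_div_iff₀ two_pos (by positivity)] at hγl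
      rw [div_le_div_iff₀ hρ hγ]
      linarith
    have hTθ : ∫ x in solid Ω ε ρ, θ x ^ 2 ≤ K * ρ ^ 2 * G :=
      h.2.1.setIntegral_sq_solid_le hΩ hΩR hε hεR hρ hρε hγu
    calc _ = β ^ 2 * (∫ x in solid Ω ε ρ, g x * θ x) ^ 2 := by ring
      _ ≤ β ^ 2 * (Bg ^ 2 * volume.real (solid Ω ε ρ) * ∫ x in solid Ω ε ρ, θ x ^ 2) := by
          gcongr
          exact sq_setIntegral_mul_le hT hfin hg hBg
            (hθ.mono_measure (Measure.restrict_mono hT le_rfl))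
      _ ≤ β ^ 2 * (Bg ^ 2 * ((3 * R / ε) ^ 3 * (ρ ^ 3 * v)) * (K * ρ ^ 2 * G)) := by
          gcongr
          exact volume_real_solid_le hΩR hε hεR hρ
      _ = b ^ 2 * Bg ^ 2 * (27 * R ^ 3) * v * K * (ε ^ 3 / ρ) * G := by
          rw [hβdef]
          field_simp
          ring
      _ ≤ _ := by gcongr
  -- The source squared is at most a constant times `G ≤ E`, so `E² ≤ C E`, and one factor `E` is
  -- absorbed.
  refine le_of_sq_le_mul (by positivity) ?_
  rw [hen]
  unfold sourceF
  set X := ∫ x in fluid Ω ε ρ, f x * θ x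
  set Z := β * ∫ x in solid Ω ε ρ, g x * θ x
  have hXZ : X + Z = E := hen.symm
  set A := Bf ^ 2 * volume.real Ω * R ^ 2 with hA
  set B := b ^ 2 * Bg ^ 2 * (27 * R ^ 3) * v * K * (2 / γ) with hB
  have hAB : 0 ≤ A + B := by positivity
  change (X + Z) ^ 2 ≤ 2 * (A + B) * (X + Z)
  calc (X + Z) ^ 2 ≤ 2 * (X ^ 2 + Z ^ 2) := by nlinarith [sq_nonneg (X - Z)]
    _ ≤ 2 * (A + B) * G := by linarith
    _ ≤ 2 * (A + B) * (X + Z) := by rw [hXZ]; gcongr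

/-- Cauchy–Schwarz on the buoyancy term and absorption. Poincaré on the fluid domain uses only the
radius `R` of `Ω`, so the holes do not affect the constant. -/
theorem IsSolution.velocity_bound {Ω : Set R3} (hΩ : IsOpen Ω)
    {a b α ε ρ R C : ℝ} (hΩR : ∀ x ∈ Ω, ‖x‖ ≤ R) (hR : 0 < R) (hα : 0 < α)
    (hW : IsOpen (fluid Ω ε ρ)) (hT : solid Ω ε ρ ⊆ Ω) {f g : R3 → ℝ} {u : R3 → R3} {θ : R3 → ℝ}
    (h : IsSolution Ω a b α ε ρ f g u θ) (hθ : ∫ x in Ω, θ x ^ 2 ≤ C) :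
    ∑ i : Fin 3, ∫ x in fluid Ω ε ρ, ‖weakGradient (fluid Ω ε ρ) (fun y => u y i) x‖ ^ 2
      ≤ a ^ 2 * C * R ^ 2 := by
  have hen := h.velocity_energy hΩ hα hW hT
  have hWΩ : fluid Ω ε ρ ⊆ Ω := Set.sdiff_subset
  have hθL : MemLp θ 2 (volume.restrict Ω) := h.2.1.1.1
  have hθW : ∫ x in fluid Ω ε ρ, θ x ^ 2 ≤ C :=
    (setIntegral_mono_set hθL.integrable_sq (Eventually.of_forall fun x => sq_nonneg _)
      hWΩ.eventuallyLE).trans hθ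
  have hC : 0 ≤ C := le_trans (integral_nonneg fun x => sq_nonneg _) hθ
  set Q := ∑ i : Fin 3,
    ∫ x in fluid Ω ε ρ, ‖weakGradient (fluid Ω ε ρ) (fun y => u y i) x‖ ^ 2 with hQ
  have hu : ∫ x in fluid Ω ε ρ, u x 2 ^ 2 ≤ R ^ 2 * Q := by
    refine ((h.1.1 2).poincare hW hR fun x hx => hΩR x (hWΩ hx)).trans ?_
    gcongr
    exact Finset.single_le_sum (f := fun i : Fin 3 =>
      ∫ x in fluid Ω ε ρ, ‖weakGradient (fluid Ω ε ρ) (fun y => u y i) x‖ ^ 2)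
      (fun i _ => integral_nonneg fun x => by positivity) (Finset.mem_univ 2)
  refine le_of_sq_le_mul (by positivity) ?_
  calc Q ^ 2 = a ^ 2 * (∫ x in fluid Ω ε ρ, θ x * u x 2) ^ 2 := by rw [hen]; ring
    _ ≤ a ^ 2 * ((∫ x in fluid Ω ε ρ, θ x ^ 2) * ∫ x in fluid Ω ε ρ, u x 2 ^ 2) := by
        gcongr
        exact sq_integral_mul_le (hθL.mono_measure (Measure.restrict_mono hWΩ le_rfl))
          (h.1.1 2).1.1
    _ ≤ a ^ 2 * (C * (R ^ 2 * Q)) := by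
        gcongr
    _ = _ := by ring

/-- The scaling regime `ρ/ε³ ≈ γ` holds for all small `ε`. -/
theorem exists_regime {b γ R : ℝ} (hb : 0 < b) (hγ : 0 < γ) (hR : 0 < R) {r : ℝ → ℝ}
    (hr : ∀ ε : ℝ, 0 < ε → 0 < r ε) (hlim : Tendsto (fun ε : ℝ => r ε / ε ^ 3) (𝓝[>] 0) (𝓝 γ)) :
    ∃ ε₀ : ℝ, 0 < ε₀ ∧ ∀ ε : ℝ, 0 < ε → ε < ε₀ → ε ≤ R ∧ r ε ≤ ε / 4 ∧ r ε / ε ^ 3 ≤ 2 * γ ∧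
      γ / 2 ≤ r ε / ε ^ 3 ∧ 1 ≤ b * (ε / r ε) ^ 3 := by
  have small : ∀ (F : ℝ → ℝ) (c : ℝ), Continuous F → F 0 < c → ∀ᶠ ε in 𝓝[>] (0 : ℝ), F ε < c :=
    fun F c hF hc => nhdsWithin_le_nhds (hF.continuousAt.eventually_lt_const hc)
  -- Once `r ε ≤ 2γε³`, smallness of `2γε²` yields both `r ε ≤ ε/4` and, after cubing, `b (ε / r ε)³
  -- ≥ 1`.
  have h1 := small (fun ε => ε) R continuous_id hR
  have h2 := small (fun ε => 2 * γ * ε ^ 2) (1 / 4) (by fun_prop) (by norm_num)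
  have h3 := small (fun ε => (2 * γ * ε ^ 2) ^ 3) b (by fun_prop) (by simpa using hb)
  have h4 := hlim.eventually_lt_const (show γ < 2 * γ by linarith)
  have h5 := hlim.eventually_const_lt (show γ / 2 < γ by linarith)
  obtain ⟨ε₀, hε₀, H⟩ := mem_nhdsGT_iff_exists_Ioo_subset.1
    (h1.and (h2.and (h3.and (h4.and h5))))
  refine ⟨ε₀, hε₀, fun ε hε hlt => ?_⟩
  obtain ⟨g1, g2, g3, g4, g5⟩ := H ⟨hε, hlt⟩
  have hrε := hr ε hε
  have hup : r ε ≤ 2 * γ * ε ^ 2 * ε := by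
    rw [div_lt_iff₀ (by positivity)] at g4
    nlinarith
  refine ⟨g1.le, ?_, g4.le, g5.le, ?_⟩
  · nlinarith
  · have h6 : 1 / (2 * γ * ε ^ 2) ≤ ε / r ε := by
      rw [div_le_div_iff₀ (by positivity) hrε]
      linarith
    calc (1 : ℝ) = (2 * γ * ε ^ 2) ^ 3 * (1 / (2 * γ * ε ^ 2)) ^ 3 := by
          field_simp
      _ ≤ b * (ε / r ε) ^ 3 := by gcongr

theorem proposition3p2
    (Ω : Set R3) (hΩ : IsOpen Ω) (hΩb : Bornology.IsBounded Ω)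
    (a b : ℝ) (ha : 0 < a) (hb : 0 < b)
    (f g : R3 → ℝ)
    (hf : Continuous f) (hfc : HasCompactSupport f) (hfs : tsupport f ⊆ Ω)
    (hg : Continuous g) (hgc : HasCompactSupport g) (hgs : tsupport g ⊆ Ω)
    (r : ℝ → ℝ) (hr : ∀ ε : ℝ, 0 < ε → 0 < r ε)
    (γ : ℝ) (hγ : 0 < γ)
    (hlim : Tendsto (fun ε : ℝ => r ε / ε ^ 3) (𝓝[>] 0) (𝓝 γ)) :
    ∃ C ε₀ : ℝ, 0 < ε₀ ∧ ∀ ε : ℝ, 0 < ε → ε < ε₀ → ∀ α : ℝ, 0 < α →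
      ∀ (u : R3 → R3) (θ : R3 → ℝ), IsSolution Ω a b α ε (r ε) f g u θ →
        (MemH10Vec Ω (zeroExt Ω ε (r ε) u) ∧ h1NormSqVec Ω (zeroExt Ω ε (r ε) u) ≤ C) ∧
        (MemH10 Ω θ ∧ h1NormSq Ω θ ≤ C) ∧
        (∫ x in fluid Ω ε (r ε), ‖weakGradient Ω θ x‖ ^ 2)
          + b * (ε / r ε) ^ 3 * (∫ x in solid Ω ε (r ε), ‖weakGradient Ω θ x‖ ^ 2) ≤ C := by
  obtain ⟨R₀, hR₀⟩ := hΩb.exists_norm_le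
  set R := max R₀ 1
  have hR : 0 < R := lt_of_lt_of_le one_pos (le_max_right _ _)
  have hΩR : ∀ x ∈ Ω, ‖x‖ ≤ R := fun x hx => (hR₀ x hx).trans (le_max_left _ _)
  have hfin : volume Ω ≠ ⊤ := hΩb.measure_lt_top.ne
  obtain ⟨Bf, hBf⟩ := hfc.exists_bound_of_continuous hf
  obtain ⟨Bg, hBg⟩ := hgc.exists_bound_of_continuous hg
  obtain ⟨ε₀, hε₀, H⟩ := exists_regime hb hγ hR hr hlim
  set C₁ := 2 * (Bf ^ 2 * volume.real Ω * R ^ 2 + b ^ 2 * Bg ^ 2 * (27 * R ^ 3)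
    * volume.real (Metric.ball (0 : R3) 1) * (11 * (2 + 576 * R ^ 2 * (2 * γ))) * (2 / γ)) with hC₁
  have hC₁0 : 0 ≤ C₁ := by positivity
  -- The sum of the three separate bounds, all nonnegative; each factor `R² + 1` turns a Dirichlet
  -- bound into an `H¹` bound by Poincaré.
  refine ⟨(R ^ 2 + 1) * (a ^ 2 * (R ^ 2 * C₁) * R ^ 2) + (R ^ 2 + 1) * C₁ + C₁, ε₀, hε₀,
    fun ε hε hlt α hα u θ h => ?_⟩
  obtain ⟨hεR, hρε, hγu, hγl, hβ⟩ := H ε hε hlt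
  have hρ := hr ε hε
  have hW : IsOpen (fluid Ω ε (r ε)) := isOpen_fluid hΩ hΩb hε _
  have hWΩ : fluid Ω ε (r ε) ⊆ Ω := Set.sdiff_subset
  have hT : solid Ω ε (r ε) ⊆ Ω := solid_subset hε (by linarith)
  obtain ⟨hG, hE⟩ := h.temperature_bound hΩ hfin hΩR hb hε hεR hρ hρε hγ hγu hγl hβ hW hf hg hBf hBg
  have hGC := hG.trans hE
  have hθ : ∫ x in Ω, θ x ^ 2 ≤ R ^ 2 * C₁ :=
    (h.2.1.poincare hΩ hR hΩR).trans (mul_le_mul_of_nonneg_left hGC (by positivity))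
  have hQ := h.velocity_bound hΩ hΩR hR hα hW hT hθ
  have e : ∀ i, (fun x => zeroExt Ω ε (r ε) u x i) = (fluid Ω ε (r ε)).indicator fun x => u x i := by
    intro i
    ext x
    by_cases hx : x ∈ fluid Ω ε (r ε) <;> simp [zeroExt, hx]
  have hp1 : 0 ≤ (R ^ 2 + 1) * (a ^ 2 * (R ^ 2 * C₁) * R ^ 2) := by positivity
  have hp2 : 0 ≤ (R ^ 2 + 1) * C₁ := by positivity
  refine ⟨⟨fun i => ?_, ?_⟩, ⟨h.2.1, ?_⟩, ?_⟩
  · rw [e]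
    exact (h.1.1 i).indicator hW hΩ hWΩ
  · have h1 : h1NormSqVec Ω (zeroExt Ω ε (r ε) u) ≤ (R ^ 2 + 1) * ∑ i : Fin 3,
        ∫ x in fluid Ω ε (r ε), ‖weakGradient (fluid Ω ε (r ε)) (fun y => u y i) x‖ ^ 2 := by
      rw [h1NormSqVec, Finset.mul_sum]
      refine Finset.sum_le_sum fun i _ => ?_
      rw [e, (h.1.1 i).h1NormSq_indicator hW hΩ hWΩ, h1NormSq, add_mul, one_mul]
      exact add_le_add_left ((h.1.1 i).poincare hW hR fun x hx => hΩR x (hWΩ hx)) _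
    have h2 := h1.trans (mul_le_mul_of_nonneg_left hQ (by positivity))
    linarith
  · unfold h1NormSq
    linarith
  · linarith
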